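/- **Conventions.** A Lie groupoid $\Sigma\rightrightarrows \mathbf X$ has a Hausdorff second countable base $\mathbf X$ and a smooth, possibly non-Hausdorff and non-second-countable, manifold of arrows; $s$ is a surjective submersion with Hausdorff fibres, and $gh$ is defined when $s(g)=t(h)$. A *Pfaffian groupoid* $(\Sigma,\omega,E)$ over $\mathbf X$ is a Lie groupoid $\Sigma\rightrightarrows\mathbf X$ with a representation $E\to\mathbf X$ and a form $\omega\in\Omega^1(\Sigma,t^*E)$ of constant rank which is multiplicative, $(m^*\omega)_{(g,h)}=(\mathrm{pr}_1^*\omega)_{(g,h)}+g\cdot(\mathrm{pr}_2^*\omega)_{(g,h)}$, and such that $T\Sigma=\ker\omega+\ker ds$, the subbundle $\ker\omega\cap\ker ds$ is involutive, and $\ker\omega\cap\ker dt=\ker\omega\cap\ker ds$. An *isomorphism* $(\Sigma,\omega,E)\cong(\Sigma',\omega',E')$ is an isomorphism $F$ of Lie groupoids together with an isomorphism $\Psi:E\to E'$ of representations over the same diffeomorphism of the bases, such that $F^*\omega'=\Psi\circ\omega$. A *(left) principal $\Sigma$-bundle* over a manifold $M$ (Hausdorff, second countable) is a manifold $P$ with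 a smooth left $\Sigma$-action along a surjective submersion $\mu:P\to\mathbf X$ and a surjective submersion $\pi:P\to M$, such that $\pi$ is invariant and the action is free, transitive on the fibres of $\pi$, and proper (the map $\Sigma\times_{\mathbf X}P\to P\times P$, $(g,p)\mapsto(g\cdot p,p)$, is proper). A *(left) principal $(\Sigma,\omega,E)$-bundle* $(P,\theta)$ is such a bundle with a form $\theta\in\Omega^1(P,\mu^*E)$ such that $(m_P^*\theta)_{(g,p)}=(\mathrm{pr}_1^*\omega)_{(g,p)}+g\cdot(\mathrm{pr}_2^*\theta)_{(g,p)}$ and $\ker d\mu\cap\ker\theta=\ker d\pi\cap\ker\theta$. *Right* principal bundles are defined analogously, with $p\cdot g$ defined when $\mu(p)=t(g)$, and with $(m_P^*\theta)_{(p,g)}=g^{-1}\cdot(\mathrm{pr}_1^*\theta)_{(p,g)}+g^{-1}\cdot(\mathrm{pr}_2^*\omega)_{(p,g)}$. Pfaffian groupoids $(\Sigma_1,\omega_1,E_1)$ over $\mathbf X_1$ and $(\Sigma_2,\omega_2,E_2)$ over $\mathbf X_2$ are *Pfaffian Morita equivalent* if there are a left principal $(\Sigma_1,\omega_1,E_1)$-bundle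 $(P,\theta)$ over $\mathbf X_2$, with moment map $\mu_1$ and projection $\mu_2:P\to\mathbf X_2$, a right action of $\Sigma_2$ on $P$ along $\mu_2$ commuting with that of $\Sigma_1$, and a vector bundle isomorphism $\Phi:\mu_1^*E_1\to\mu_2^*E_2$ over $P$, such that $(P,\Phi\circ\theta)$ is a right principal $(\Sigma_2,\omega_2,E_2)$-bundle over $\mathbf X_1$ with projection $\mu_1$, and $\Phi_{g_1\cdot p}(g_1\cdot\alpha)=\Phi_p(\alpha)$ and $\Phi_{p\cdot g_2}(\alpha)=g_2^{-1}\cdot\Phi_p(\alpha)$ whenever these expressions are defined. Let $(P,\theta)$ be a left principal $(\Sigma,\omega,E)$-bundle over $M$ with moment map $\mu:P\to\mathbf X$ and projection $\pi$. Its *gauge groupoid* $(\mathrm{Gauge}(P),\omega_{\rm gauge},E_{\rm gauge})$ over $M$ has as arrows the quotient manifold $(P\times_{\mathbf X}P)/\Sigma$ of $P\times_{\mathbf X}P=\{(p,p'):\mu(p)=\mu(p')\}$ by the diagonal action (the quotient projection being a surjective submersion), with $t[p,p']=\pi(p)$, $s[p,p']=\pi(p')$ and $[p,p'][p',p'']=[p,p'']$;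 $E_{\rm gauge}$ is the vector bundle $\mu^*E/\Sigma\to M$, the quotient by $g\cdot(p,e)=(g\cdot p,g\cdot e)$, with the representation $[p,p']\cdot[p',e]=[p,e]$; and $\omega_{\rm gauge}$ is the form induced by $\mathrm{pr}_2^*\theta-\mathrm{pr}_1^*\theta$ on $P\times_{\mathbf X}P$, that is, the pullback of $\omega_{\rm gauge}$ to $P\times_{\mathbf X}P$ is, at $(p,p')$, $(v,v')\mapsto[p,\theta(v')-\theta(v)]$. **Theorem.** Let $(\Sigma_1,\omega_1,E_1)$ and $(\Sigma_2,\omega_2,E_2)$ be Pfaffian groupoids over $\mathbf X_1$ and $\mathbf X_2$. They are Pfaffian Morita equivalent if and only if there exist a manifold $M$ and a left principal $(\Sigma_1,\omega_1,E_1)$-bundle $(P,\theta)$ over $M$ such that $(\mathrm{Gauge}(P),(\omega_1)_{\rm gauge},(E_1)_{\rm gauge})$ is a Pfaffian groupoid isomorphic to $(\Sigma_2,\omega_2,E_2)$. -/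

import Mathlib

open Bundle Set
open scoped Manifold ContDiff

universe u

namespace Pfaffian

/-- A smooth manifold of dimension `dim`, without boundary. It may be non-Hausdorff and
non-second-countable; these two properties are required separately where they are needed. -/
structure SmoothManifold : Type (u + 1) where
  carrier : Type u
  dim : ℕ
  [top : TopologicalSpace carrier]
  [charts : ChartedSpace (EuclideanSpace ℝ (Fin dim)) carrier]
  [smooth : IsManifold (𝓡 dim) ∞ carrier]

instance : CoeSort SmoothManifold.{u} (Type u) := ⟨SmoothManifold.carrier⟩

attribute [instance] SmoothManifold.top SmoothManifold.charts SmoothManifold.smooth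

/-- Smooth maps. -/
abbrev SmoothMap (M N : SmoothManifold.{u}) := ContMDiffMap (𝓡 M.dim) (𝓡 N.dim) M N ∞

/-- Diffeomorphisms. -/
abbrev Diffeo (M N : SmoothManifold.{u}) := Diffeomorph (𝓡 M.dim) (𝓡 N.dim) M N ∞

/-- The tangent space of `M` at `p`. -/
abbrev Tan (M : SmoothManifold.{u}) (p : M) := TangentSpace (𝓡 M.dim) p

/-- The differential of a map between manifolds at a point. -/
noncomputable abbrev D {M N : SmoothManifold.{u}} (f : M → N) (p : M) : Tan M p →L[ℝ] Tan N (f p) :=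
  mfderiv (𝓡 M.dim) (𝓡 N.dim) f p

/-- Surjective submersions. -/
def IsSurjSubmersion {M N : SmoothManifold.{u}} (f : M → N) : Prop :=
  Function.Surjective f ∧ Manifold.IsSubmersion (𝓡 M.dim) (𝓡 N.dim) ∞ f

/-- `f : M → N → L` is smooth on the subset `s` of `M × N`. It is used for fibre products `s` of two
submersions, which are embedded submanifolds of `M × N`; there it is smoothness of the
restriction of `f` to the submanifold `s`. -/
def SmoothOn₂ {M N L : SmoothManifold.{u}} (f : M → N → L) (s : Set (M × N)) : Prop :=
  ContMDiffOn ((𝓡 M.dim).prod (𝓡 N.dim)) (𝓡 L.dim) ∞ (fun z : M × N => f z.1 z.2) s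

/-- The differential at `(p, q)`, applied to `(v, w)`, of the restriction of `f : M → N → L` to the
subset `s` of `M × N`. If `s` is an embedded submanifold, then `mfderivWithin` is determined on the
vectors `(v, w)` tangent to `s`, and it is only ever applied to such vectors. -/
noncomputable def D₂ {M N L : SmoothManifold.{u}} (f : M → N → L) (s : Set (M × N)) (p : M) (q : N)
    (v : Tan M p) (w : Tan N q) : Tan L (f p q) :=
  mfderivWithin ((𝓡 M.dim).prod (𝓡 N.dim)) (𝓡 L.dim) (fun z : M × N => f z.1 z.2) s (p, q) (v, w)

/-- A family of tangent subspaces is involutive if it is closed under brackets of the smooth vector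
fields, defined on open subsets, that take values in it. -/
def Involutive {M : SmoothManifold.{u}} (K : ∀ p : M, Submodule ℝ (Tan M p)) : Prop :=
  ∀ (U : Set M), IsOpen U → ∀ V W : (∀ p : M, Tan M p),
    ContMDiffOn (𝓡 M.dim) (𝓡 M.dim).tangent ∞ (fun p => (⟨p, V p⟩ : TangentBundle (𝓡 M.dim) M)) U →
    ContMDiffOn (𝓡 M.dim) (𝓡 M.dim).tangent ∞ (fun p => (⟨p, W p⟩ : TangentBundle (𝓡 M.dim) M)) U →
    (∀ p ∈ U, V p ∈ K p) → (∀ p ∈ U, W p ∈ K p) →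
    ∀ p ∈ U, VectorField.mlieBracket (𝓡 M.dim) V W p ∈ K p

/-! ### Vector bundles and vector-bundle-valued 1-forms -/

/-- A smooth real vector bundle of rank `rank` over `X`. -/
structure VecBundle (X : SmoothManifold.{u}) : Type (u + 1) where
  rank : ℕ
  Fib : X → Type u
  [addCommGroup : ∀ x, AddCommGroup (Fib x)]
  [module : ∀ x, Module ℝ (Fib x)]
  [fibTop : ∀ x, TopologicalSpace (Fib x)]
  [totTop : TopologicalSpace (TotalSpace (EuclideanSpace ℝ (Fin rank)) Fib)]
  [fiberBundle : FiberBundle (EuclideanSpace ℝ (Fin rank)) Fib]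
  [vectorBundle : VectorBundle ℝ (EuclideanSpace ℝ (Fin rank)) Fib]
  [smooth : ContMDiffVectorBundle ∞ (EuclideanSpace ℝ (Fin rank)) Fib (𝓡 X.dim)]

attribute [instance] VecBundle.addCommGroup VecBundle.module VecBundle.fibTop VecBundle.totTop
  VecBundle.fiberBundle VecBundle.vectorBundle VecBundle.smooth

namespace VecBundle

/-- The model fibre. -/
abbrev Model {X : SmoothManifold.{u}} (E : VecBundle X) := EuclideanSpace ℝ (Fin E.rank)

/-- The total space. -/
abbrev Tot {X : SmoothManifold.{u}} (E : VecBundle X) := TotalSpace E.Model E.Fib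

end VecBundle

/-- A family of linear maps `E_{μ p} → F_{ν p}`, `p ∈ P`. To avoid transport along equalities of base
points, source and target fibres are indexed by points `x = μ p` and `y = ν p`. -/
abbrev FibreMaps {P X Y : SmoothManifold.{u}} (μ : P → X) (ν : P → Y) (E : VecBundle X)
    (F : VecBundle Y) :=
  ∀ (p : P) ⦃x : X⦄ ⦃y : Y⦄, μ p = x → ν p = y → (E.Fib x →ₗ[ℝ] F.Fib y)

/-- The same with linear isomorphisms. -/
abbrev FibreEquivs {P X Y : SmoothManifold.{u}} (μ : P → X) (ν : P → Y) (E : VecBundle X)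
    (F : VecBundle Y) :=
  ∀ (p : P) ⦃x : X⦄ ⦃y : Y⦄, μ p = x → ν p = y → (E.Fib x ≃ₗ[ℝ] F.Fib y)

/-- A family of maps `E_{μ p} → F_{ν p}` depends smoothly on `p`: the induced map
`μ^* E → F`, `(p, e) ↦ f_p e`, is smooth. -/
def SmoothFibreMaps {P X Y : SmoothManifold.{u}} (μ : SmoothMap P X) (ν : P → Y) (E : VecBundle X)
    (F : VecBundle Y) (f : ∀ p : P, E.Fib (μ p) → F.Fib (ν p)) : Prop :=
  ContMDiff ((𝓡 P.dim).prod 𝓘(ℝ, E.Model)) ((𝓡 Y.dim).prod 𝓘(ℝ, F.Model)) ∞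
    (fun z : TotalSpace E.Model ((μ : P → X) *ᵖ E.Fib) => (⟨ν z.1, f z.1 z.2⟩ : F.Tot))

/-- A family of linear isomorphisms is an isomorphism of smooth vector bundles
`μ^* E → ν^* F`. -/
def IsBundleIso {P X Y : SmoothManifold.{u}} (μ : SmoothMap P X) (ν : SmoothMap P Y)
    (E : VecBundle X) (F : VecBundle Y) (f : FibreEquivs μ ν E F) : Prop :=
  SmoothFibreMaps μ ν E F (fun p => f p rfl rfl) ∧
    SmoothFibreMaps ν μ F E (fun p => (f p rfl rfl).symm)

/-- (Not necessarily smooth) 1-forms on `P` with values in `μ^* E`: linear maps `T_p P → E_x`, where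
`x = μ p`. -/
abbrev PreForm {P X : SmoothManifold.{u}} (μ : P → X) (E : VecBundle X) :=
  ∀ (p : P) ⦃x : X⦄, μ p = x → (Tan P p →ₗ[ℝ] E.Fib x)

/-- Smoothness of a 1-form `θ` on `P` with values in `μ^* E`: the induced map `T P → E`
is smooth. -/
def SmoothForm {P X : SmoothManifold.{u}} (μ : P → X) (E : VecBundle X) (θ : PreForm μ E) : Prop :=
  ContMDiff (𝓡 P.dim).tangent ((𝓡 X.dim).prod 𝓘(ℝ, E.Model)) ∞
    (fun v : TangentBundle (𝓡 P.dim) P => (⟨μ v.1, θ v.1 rfl v.2⟩ : E.Tot))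

/-! ### Lie groupoids and Pfaffian groupoids -/

/-- A Lie groupoid `Arr ⇉ X`. The product `mul g h` is meaningful when `src g = tgt h`; its other
values are irrelevant. The source map is surjective because of `src_unit`. -/
structure LieGroupoid (X : SmoothManifold.{u}) : Type (u + 1) where
  Arr : SmoothManifold.{u}
  src : SmoothMap Arr X
  tgt : SmoothMap Arr X
  unit : SmoothMap X Arr
  inv : SmoothMap Arr Arr
  mul : Arr → Arr → Arr
  smooth_mul : SmoothOn₂ mul {z | src z.1 = tgt z.2}
  src_mul : ∀ g h, src g = tgt h → src (mul g h) = src h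
  tgt_mul : ∀ g h, src g = tgt h → tgt (mul g h) = tgt g
  mul_assoc : ∀ g h k, src g = tgt h → src h = tgt k → mul (mul g h) k = mul g (mul h k)
  src_unit : ∀ x, src (unit x) = x
  tgt_unit : ∀ x, tgt (unit x) = x
  unit_mul : ∀ g, mul (unit (tgt g)) g = g
  mul_unit : ∀ g, mul g (unit (src g)) = g
  src_inv : ∀ g, src (inv g) = tgt g
  tgt_inv : ∀ g, tgt (inv g) = src g
  inv_mul : ∀ g, mul (inv g) g = unit (src g)
  mul_inv : ∀ g, mul g (inv g) = unit (tgt g)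
  submersion_src : IsSurjSubmersion src
  t2_fibres : ∀ x, T2Space {g : Arr // src g = x}
  t2_base : T2Space X
  secondCountable_base : SecondCountableTopology X

/-- The set of composable pairs of arrows. -/
def LieGroupoid.Composable {X : SmoothManifold.{u}} (S : LieGroupoid X) : Set (S.Arr × S.Arr) :=
  {z | S.src z.1 = S.tgt z.2}

/-- A Pfaffian groupoid `(Σ, ω, E)` over `X`. The representation is `g ↦ rep g : E_x → E_y`
for an arrow `g : x → y`. -/
structure PfaffianGroupoid (X : SmoothManifold.{u}) : Type (u + 1) extends LieGroupoid X where
  E : VecBundle X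
  rep : FibreMaps src tgt E E
  rep_unit : ∀ (x : X) (e : E.Fib x), rep (unit x) (src_unit x) (tgt_unit x) e = e
  rep_mul : ∀ (g h : Arr) (hgh : src g = tgt h) ⦃x y : X⦄ (hx : src h = x) (hy : tgt g = y)
    (e : E.Fib x), rep (mul g h) ((src_mul g h hgh).trans hx) ((tgt_mul g h hgh).trans hy) e =
      rep g rfl hy (rep h hx hgh.symm e)
  smooth_rep : SmoothFibreMaps src tgt E E (fun g => rep g rfl rfl)
  form : PreForm tgt E
  smooth_form : SmoothForm tgt E form
  /-- `m^* ω = pr₁^* ω + g · pr₂^* ω` on the manifold of composable pairs `(g, h)`. -/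
  multiplicative : ∀ (g h : Arr) (hgh : src g = tgt h) (v : Tan Arr g) (w : Tan Arr h),
    D src g v = D tgt h w →
    form (mul g h) (tgt_mul g h hgh) (D₂ mul toLieGroupoid.Composable g h v w) =
      form g rfl v + rep g hgh rfl (form h rfl w)
  constant_rank : ∃ r : ℕ, ∀ g : Arr, Module.finrank ℝ (LinearMap.range (form g rfl)) = r
  transversal : ∀ g : Arr, LinearMap.ker (form g rfl) ⊔ (D src g).ker = ⊤
  involutive : Involutive (fun g : Arr => LinearMap.ker (form g rfl) ⊓ (D src g).ker)
  ker_eq : ∀ g : Arr, LinearMap.ker (form g rfl) ⊓ (D tgt g).ker =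
    LinearMap.ker (form g rfl) ⊓ (D src g).ker

/-- An isomorphism of Pfaffian groupoids `(Σ₁, ω₁, E₁) ≅ (Σ₂, ω₂, E₂)`: an isomorphism
`Φ` of Lie groupoids and an isomorphism `Ψ` of representations, both covering `φ`, with
`Φ^* ω₂ = Ψ ∘ ω₁`. -/
structure PfaffianIso {X₁ X₂ : SmoothManifold.{u}} (S₁ : PfaffianGroupoid X₁)
    (S₂ : PfaffianGroupoid X₂) where
  φ : Diffeo X₁ X₂
  Φ : Diffeo S₁.Arr S₂.Arr
  src_Φ : ∀ g, S₂.src (Φ g) = φ (S₁.src g)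
  tgt_Φ : ∀ g, S₂.tgt (Φ g) = φ (S₁.tgt g)
  Φ_mul : ∀ g h, S₁.src g = S₁.tgt h → Φ (S₁.mul g h) = S₂.mul (Φ g) (Φ h)
  Ψ : ∀ ⦃x : X₁⦄ ⦃y : X₂⦄, φ x = y → (S₁.E.Fib x ≃ₗ[ℝ] S₂.E.Fib y)
  smooth_Ψ : ContMDiff ((𝓡 X₁.dim).prod 𝓘(ℝ, S₁.E.Model)) ((𝓡 X₂.dim).prod 𝓘(ℝ, S₂.E.Model)) ∞
    (fun z : S₁.E.Tot => (⟨φ z.1, Ψ rfl z.2⟩ : S₂.E.Tot))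
  smooth_Ψ_symm :
    ContMDiff ((𝓡 X₂.dim).prod 𝓘(ℝ, S₂.E.Model)) ((𝓡 X₁.dim).prod 𝓘(ℝ, S₁.E.Model)) ∞
    (fun z : S₂.E.Tot => (⟨φ.symm z.1, (Ψ (φ.apply_symm_apply z.1)).symm z.2⟩ : S₁.E.Tot))
  Ψ_rep : ∀ (g : S₁.Arr) (e : S₁.E.Fib (S₁.src g)),
    Ψ rfl (S₁.rep g rfl rfl e) = S₂.rep (Φ g) (src_Φ g) (tgt_Φ g) (Ψ rfl e)
  pullback_form : ∀ (g : S₁.Arr) (v : Tan S₁.Arr g),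
    S₂.form (Φ g) (tgt_Φ g) (D Φ g v) = Ψ rfl (S₁.form g rfl v)

/-! ### Principal bundles -/

/-- The left action `act` (meaningful on pairs `(g, p)` with `src g = μ p`) of `S` along the moment
map `μ` makes `proj : P → M` into a left principal `S`-bundle over `M`. The moment map is
a surjective submersion. -/
structure IsLeftPrincipal {X P M : SmoothManifold.{u}} (S : LieGroupoid X) (μ : SmoothMap P X)
    (proj : SmoothMap P M) (act : S.Arr → P → P) : Prop where
  smooth_act : SmoothOn₂ act {z | S.src z.1 = μ z.2}
  μ_act : ∀ g p, S.src g = μ p → μ (act g p) = S.tgt g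
  mul_act : ∀ g h p, S.src g = S.tgt h → S.src h = μ p → act (S.mul g h) p = act g (act h p)
  unit_act : ∀ p, act (S.unit (μ p)) p = p
  submersion_μ : IsSurjSubmersion μ
  submersion_proj : IsSurjSubmersion proj
  proj_act : ∀ g p, S.src g = μ p → proj (act g p) = proj p
  transitive : ∀ p p', proj p = proj p' → ∃ g, S.src g = μ p ∧ act g p = p'
  free : ∀ g p, S.src g = μ p → act g p = p → g = S.unit (μ p)
  proper : IsProperMap
    (fun z : {z : S.Arr × P // S.src z.1 = μ z.2} => (act z.1.1 z.1.2, z.1.2))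
  t2_base : T2Space M
  secondCountable_base : SecondCountableTopology M

/-- The right action `act` (meaningful on pairs `(p, g)` with `μ p = tgt g`) of `S` along the moment
map `μ` makes `proj : P → M` into a right principal `S`-bundle over `M`. -/
structure IsRightPrincipal {X P M : SmoothManifold.{u}} (S : LieGroupoid X) (μ : SmoothMap P X)
    (proj : SmoothMap P M) (act : P → S.Arr → P) : Prop where
  smooth_act : SmoothOn₂ act {z | μ z.1 = S.tgt z.2}
  μ_act : ∀ p g, μ p = S.tgt g → μ (act p g) = S.src g
  act_mul : ∀ p g h, μ p = S.tgt g → S.src g = S.tgt h → act p (S.mul g h) = act (act p g) h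
  act_unit : ∀ p, act p (S.unit (μ p)) = p
  submersion_μ : IsSurjSubmersion μ
  submersion_proj : IsSurjSubmersion proj
  proj_act : ∀ p g, μ p = S.tgt g → proj (act p g) = proj p
  transitive : ∀ p p', proj p = proj p' → ∃ g, μ p = S.tgt g ∧ act p g = p'
  free : ∀ p g, μ p = S.tgt g → act p g = p → g = S.unit (μ p)
  proper : IsProperMap
    (fun z : {z : P × S.Arr // μ z.1 = S.tgt z.2} => (z.1.1, act z.1.1 z.1.2))
  t2_base : T2Space M
  secondCountable_base : SecondCountableTopology M

/-- `proj : P → M` with the form `θ ∈ Ω¹(P, μ^* E)` is a left principal `(Σ, ω, E)`-bundle. -/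
structure IsLeftPfaffian {X P M : SmoothManifold.{u}} (S : PfaffianGroupoid X) (μ : SmoothMap P X)
    (proj : SmoothMap P M) (act : S.Arr → P → P) (θ : PreForm μ S.E) : Prop where
  principal : IsLeftPrincipal S.toLieGroupoid μ proj act
  smooth_θ : SmoothForm μ S.E θ
  /-- `m_P^* θ = pr₁^* ω + g · pr₂^* θ`. -/
  multiplicative : ∀ (g : S.Arr) (p : P) (h : S.src g = μ p) (v : Tan S.Arr g) (w : Tan P p),
    D S.src g v = D μ p w →
    θ (act g p) (principal.μ_act g p h) (D₂ act {z | S.src z.1 = μ z.2} g p v w) =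
      S.form g rfl v + S.rep g h rfl (θ p rfl w)
  ker_eq : ∀ p : P, (D μ p).ker ⊓ LinearMap.ker (θ p rfl) =
    (D proj p).ker ⊓ LinearMap.ker (θ p rfl)

/-- `proj : P → M` with the form `θ ∈ Ω¹(P, μ^* E)` is a right principal `(Σ, ω, E)`-bundle. -/
structure IsRightPfaffian {X P M : SmoothManifold.{u}} (S : PfaffianGroupoid X) (μ : SmoothMap P X)
    (proj : SmoothMap P M) (act : P → S.Arr → P) (θ : PreForm μ S.E) : Prop where
  principal : IsRightPrincipal S.toLieGroupoid μ proj act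
  smooth_θ : SmoothForm μ S.E θ
  /-- `m_P^* θ = g⁻¹ · pr₁^* θ + g⁻¹ · pr₂^* ω`. -/
  multiplicative : ∀ (p : P) (g : S.Arr) (h : μ p = S.tgt g) (v : Tan P p) (w : Tan S.Arr g),
    D μ p v = D S.tgt g w →
    θ (act p g) (principal.μ_act p g h) (D₂ act {z | μ z.1 = S.tgt z.2} p g v w) =
      S.rep (S.inv g) (S.src_inv g) (S.tgt_inv g) (θ p h v) +
        S.rep (S.inv g) (S.src_inv g) (S.tgt_inv g) (S.form g rfl w)
  ker_eq : ∀ p : P, (D μ p).ker ⊓ LinearMap.ker (θ p rfl) =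
    (D proj p).ker ⊓ LinearMap.ker (θ p rfl)

/-- A (left) principal `(Σ, ω, E)`-bundle `(P, θ)` over `M`. -/
structure PrincipalPfaffianBundle {X : SmoothManifold.{u}} (S : PfaffianGroupoid X)
    (M : SmoothManifold.{u}) : Type (u + 1) where
  P : SmoothManifold.{u}
  μ : SmoothMap P X
  proj : SmoothMap P M
  act : S.Arr → P → P
  θ : PreForm μ S.E
  isPfaffian : IsLeftPfaffian S μ proj act θ

/-! ### Pfaffian Morita equivalence -/

/-- A principal Pfaffian bibundle `(P, θ, Φ)` between `(Σ₁, ω₁, E₁)` and `(Σ₂, ω₂, E₂)`. -/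
structure PrincipalPfaffianBibundle {X₁ X₂ : SmoothManifold.{u}} (S₁ : PfaffianGroupoid X₁)
    (S₂ : PfaffianGroupoid X₂) : Type (u + 1) where
  P : SmoothManifold.{u}
  μ₁ : SmoothMap P X₁
  μ₂ : SmoothMap P X₂
  act₁ : S₁.Arr → P → P
  act₂ : P → S₂.Arr → P
  θ : PreForm μ₁ S₁.E
  Φ : FibreEquivs μ₁ μ₂ S₁.E S₂.E
  isBundleIso : IsBundleIso μ₁ μ₂ S₁.E S₂.E Φ
  left : IsLeftPfaffian S₁ μ₁ μ₂ act₁ θ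
  right : IsRightPfaffian S₂ μ₂ μ₁ act₂
    (fun p _ hy => (Φ p rfl hy).toLinearMap ∘ₗ θ p rfl)
  commute : ∀ g p h, S₁.src g = μ₁ p → μ₂ p = S₂.tgt h →
    act₂ (act₁ g p) h = act₁ g (act₂ p h)
  /-- `Φ_{g₁ p} (g₁ · α) = Φ_p α`. -/
  Φ_left : ∀ (g : S₁.Arr) (p : P) (h : S₁.src g = μ₁ p) (α : S₁.E.Fib (μ₁ p)),
    Φ (act₁ g p) (left.principal.μ_act g p h) (left.principal.proj_act g p h)
      (S₁.rep g h rfl α) = Φ p rfl rfl α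
  /-- `Φ_{p g₂} α = g₂⁻¹ · Φ_p α`. -/
  Φ_right : ∀ (p : P) (g : S₂.Arr) (h : μ₂ p = S₂.tgt g) (α : S₁.E.Fib (μ₁ p)),
    Φ (act₂ p g) (right.principal.proj_act p g h) (right.principal.μ_act p g h) α =
      S₂.rep (S₂.inv g) (S₂.src_inv g) (S₂.tgt_inv g) (Φ p rfl h α)

/-- Pfaffian Morita equivalence. -/
def PfaffianMoritaEquivalent {X₁ X₂ : SmoothManifold.{u}} (S₁ : PfaffianGroupoid X₁)
    (S₂ : PfaffianGroupoid X₂) : Prop :=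
  Nonempty (PrincipalPfaffianBibundle S₁ S₂)

/-! ### The gauge groupoid -/

/-- The fibre product `P ×_X P` along the moment map. -/
def PrincipalPfaffianBundle.FibreSquare {X M : SmoothManifold.{u}} {S : PfaffianGroupoid X}
    (B : PrincipalPfaffianBundle S M) : Set (B.P × B.P) :=
  {z | B.μ z.1 = B.μ z.2}

/-- `G` is the Pfaffian gauge groupoid `(Gauge(P), ω_gauge, E_gauge)` of the principal
`(Σ, ω, E)`-bundle `(P, θ)` over `M`.

* The manifold of arrows of `G` is the quotient manifold of `P ×_X P` by the diagonal action of `Σ`: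
  the projection `q`, `(p, p') ↦ [p, p']`, is a surjective submersion whose fibres are the orbits.
* The arrow `[p, p']` goes from `proj p'` to `proj p`, and `[p, p'] · [p', p''] = [p, p'']`. (This
  determines the units `[p, p]` and the inverses `[p', p]`.)
* The vector bundle `E_gauge` is the quotient bundle of `μ^* E` by the action
  `g · (p, e) = (g p, g e)`: the projection `μ^* E → E_gauge`, `(p, e) ↦ [p, e] = j_p e` over `proj` is
  invariant and identifies `μ^* E` with `proj^* E_gauge`.
* The representation is `[p, p'] · [p', e] = [p, e]`.
* The form `ω_gauge` is the form to which `pr₂^* θ - pr₁^* θ` on `P ×_X P` descends.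

These conditions determine `G` up to isomorphism. -/
structure PfaffianGauge {X M : SmoothManifold.{u}} {S : PfaffianGroupoid X}
    (B : PrincipalPfaffianBundle S M) (G : PfaffianGroupoid M) where
  q : B.P → B.P → G.Arr
  smooth_q : SmoothOn₂ q B.FibreSquare
  submersion_q : ∀ p p', B.μ p = B.μ p' → ∀ u : Tan G.Arr (q p p'),
    ∃ (v : Tan B.P p) (w : Tan B.P p'), D B.μ p v = D B.μ p' w ∧ D₂ q B.FibreSquare p p' v w = u
  surjective_q : ∀ a : G.Arr, ∃ p p', B.μ p = B.μ p' ∧ q p p' = a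
  q_eq_iff : ∀ p p' r r', B.μ p = B.μ p' → B.μ r = B.μ r' →
    (q p p' = q r r' ↔ ∃ g, S.src g = B.μ p ∧ B.act g p = r ∧ B.act g p' = r')
  src_q : ∀ p p', B.μ p = B.μ p' → G.src (q p p') = B.proj p'
  tgt_q : ∀ p p', B.μ p = B.μ p' → G.tgt (q p p') = B.proj p
  mul_q : ∀ p p' p'', B.μ p = B.μ p' → B.μ p' = B.μ p'' →
    G.mul (q p p') (q p' p'') = q p p''
  j : FibreEquivs B.μ B.proj S.E G.E
  isBundleIso_j : IsBundleIso B.μ B.proj S.E G.E j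
  j_act : ∀ (g : S.Arr) (p : B.P) (h : S.src g = B.μ p) (e : S.E.Fib (B.μ p)),
    j (B.act g p) (B.isPfaffian.principal.μ_act g p h) (B.isPfaffian.principal.proj_act g p h)
      (S.rep g h rfl e) = j p rfl rfl e
  rep_q : ∀ (p p' : B.P) (h : B.μ p = B.μ p') (e : S.E.Fib (B.μ p')),
    G.rep (q p p') (src_q p p' h) (tgt_q p p' h) (j p' rfl rfl e) = j p h rfl e
  form_q : ∀ (p p' : B.P) (h : B.μ p = B.μ p') (v : Tan B.P p) (w : Tan B.P p'),
    D B.μ p v = D B.μ p' w →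
    G.form (q p p') (tgt_q p p' h) (D₂ q B.FibreSquare p p' v w) =
      j p h rfl (B.θ p' rfl w - B.θ p h v)

end Pfaffian

/-! In a bibundle `P`, the groupoid `S₂` acts freely and transitively on the fibres of `μ₁`. Two
points with `μ₁ p = μ₁ p'` therefore determine a unique arrow `q p p'` with `p · q p p' = p'`. The
actions commute, so `q` is constant on orbits of the diagonal action of `S₁`, and transitivity of
`S₁` on the fibres of `μ₂` makes the fibres of `q` exactly these orbits. Hence `S₂` itself is a
gauge groupoid of `P`, with `j = Φ`. Solving the multiplicativity of `Φ ∘ θ` for the form of `S₂`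
gives `Φ (θ w - θ v)`, which is the gauge form (`PrincipalPfaffianBibundle.nonempty_gauge`).

Conversely a gauge groupoid acts on `P` from the right by `p · [p, p'] = p'`, and the same formulas,
read backwards, make `P` a bibundle (`PfaffianGauge.toBibundle`). An isomorphism from the gauge
groupoid to `S₂` transports it to a bibundle with `S₂` (`PrincipalPfaffianBibundle.trans`).

The analytic core, needed in both directions, is smoothness of the division map
(`IsRightPrincipal.exists_division`). Freeness and properness make `(p, g) ↦ (p, p · g)` a closed
embedding, so division is continuous. For smoothness this map must also be an immersion, whereas
only freeness on points is assumed. If an infinitesimal generator `α` acts by zero at `p`, the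
integral curve of the corresponding invariant vector field on arrows maps to an integral curve in
`P` starting at a zero, hence constant; freeness makes the curve of arrows constant, so `α = 0`
(`generator_eq_zero`, `IsRightPrincipal.eq_zero_of_D₂_act_eq_zero`). The inverse function theorem
then applies.

Fibre products are never given a manifold structure. Local retractions onto them come from
`IsFibreProjectionAt`, and tangent vectors to them are represented by curves inside them
(`HasVelocity`). Identities between differentials are mostly proved by computing the velocity of one
curve in two ways. -/

namespace Pfaffian

open Filter Topology

/-! ### Calculus in normed spaces: local inverses and sections, and an ODE argument for generators.
-/

section Analysis

variable {E F G : Type*} [NormedAddCommGroup E] [NormedSpace ℝ E] [NormedAddCommGroup F]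
  [NormedSpace ℝ F] [NormedAddCommGroup G] [NormedSpace ℝ G]

/-- A map with invertible derivative has a smooth local inverse. -/
theorem exists_contDiffAt_leftInverse_of_hasFDerivAt_id [CompleteSpace E] {H : E → E} {z₀ : E}
    (hH : ContDiffAt ℝ ∞ H z₀) (hd : HasFDerivAt H (ContinuousLinearMap.id ℝ E) z₀) :
    ∃ K : E → E, ContDiffAt ℝ ∞ K (H z₀) ∧ K (H z₀) = z₀ ∧ (∀ᶠ z in 𝓝 z₀, K (H z) = z) ∧
      ∀ᶠ y in 𝓝 (H z₀), H (K y) = y := by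
  have hd' : HasFDerivAt H ((ContinuousLinearEquiv.refl ℝ E : E ≃L[ℝ] E) : E →L[ℝ] E) z₀ := hd
  have hn : (∞ : WithTop ℕ∞) ≠ 0 := by simp
  have hs := hH.hasStrictFDerivAt' hd' hn
  exact ⟨hH.localInverse hd' hn, hH.to_localInverse hd' hn, hs.localInverse_apply_image,
    hs.eventually_left_inverse, hs.eventually_right_inverse⟩

/-- A linear map factors through another one with smaller kernel. -/
theorem exists_comp_eq_of_ker_le (A : E →ₗ[ℝ] F) (R : E →ₗ[ℝ] G)
    (h : LinearMap.ker A ≤ LinearMap.ker R) : ∃ L : F →ₗ[ℝ] G, L ∘ₗ A = R := by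
  obtain ⟨L, hL⟩ := LinearMap.exists_extend
    (((LinearMap.ker A).liftQ R h) ∘ₗ A.quotKerEquivRange.symm.toLinearMap)
  refine ⟨L, LinearMap.ext fun v => ?_⟩
  have h1 := LinearMap.congr_fun hL (A.quotKerEquivRange (Submodule.Quotient.mk v))
  simpa [LinearMap.quotKerEquivRange_apply_mk] using h1

/-- An immersion of a smooth local retract has a smooth local left inverse. -/
theorem exists_contDiffAt_leftInverse [CompleteSpace E] [FiniteDimensional ℝ F]
    {r : E → E} {f : E → F} {z₀ : E} (hr : ContDiffAt ℝ ∞ r z₀) (hf : ContDiffAt ℝ ∞ f z₀)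
    (hr₀ : r z₀ = z₀) (hker : ∀ v, fderiv ℝ f z₀ v = 0 → fderiv ℝ r z₀ v = 0) :
    ∃ k : F → E, ContDiffAt ℝ ∞ k (f z₀) ∧ k (f z₀) = z₀ ∧
      ∀ᶠ z in 𝓝 z₀, r z = z → k (f z) = z := by
  obtain ⟨L', hL'⟩ := exists_comp_eq_of_ker_le (fderiv ℝ f z₀ : E →ₗ[ℝ] F)
    (fderiv ℝ r z₀ : E →ₗ[ℝ] E) hker
  set L : F →L[ℝ] E := LinearMap.toContinuousLinearMap L'
  have hn : (∞ : WithTop ℕ∞) ≠ 0 := by simp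
  have hLf : L.comp (fderiv ℝ f z₀) = fderiv ℝ r z₀ := by
    ext v
    exact LinearMap.congr_fun hL' v
  -- The correction `z - r z` makes the derivative `dr + (id - dr) = id`, and it vanishes where `r z
  -- = z`. There the inverse `K` of this map recovers `z` from `L (f z)` alone.
  have hH : ContDiffAt ℝ ∞ (fun z => L (f z) + (z - r z)) z₀ :=
    (L.contDiff.contDiffAt.comp z₀ hf).add (contDiffAt_id.sub hr)
  have hd : HasFDerivAt (fun z => L (f z) + (z - r z)) (ContinuousLinearMap.id ℝ E) z₀ := by
    have h1 := (L.hasFDerivAt.comp z₀ (hf.differentiableAt hn).hasFDerivAt).add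
      ((hasFDerivAt_id z₀).sub (hr.differentiableAt hn).hasFDerivAt)
    rw [hLf, add_sub_cancel] at h1
    exact h1
  obtain ⟨K, hK, hK₀, hK₁, -⟩ := exists_contDiffAt_leftInverse_of_hasFDerivAt_id hH hd
  have e₀ : L (f z₀) + (z₀ - r z₀) = L (f z₀) := by rw [hr₀]; simp
  simp only [e₀] at hK hK₀
  refine ⟨fun y => K (L y), hK.comp (f z₀) L.contDiff.contDiffAt, hK₀, ?_⟩
  filter_upwards [hK₁] with z hz hrz
  simpa [hrz] using hz

/-- A map with surjective derivative has a smooth local section. -/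
theorem exists_contDiffAt_section [CompleteSpace F] [FiniteDimensional ℝ F]
    {f : E → F} {z₀ : E} (hf : ContDiffAt ℝ ∞ f z₀)
    (hsurj : Function.Surjective (fderiv ℝ f z₀)) :
    ∃ k : F → E, ContDiffAt ℝ ∞ k (f z₀) ∧ k (f z₀) = z₀ ∧ ∀ᶠ y in 𝓝 (f z₀), f (k y) = y := by
  obtain ⟨L', hL'⟩ := LinearMap.exists_rightInverse_of_surjective
    (fderiv ℝ f z₀ : E →ₗ[ℝ] F) (LinearMap.range_eq_top.2 hsurj)
  set L : F →L[ℝ] E := LinearMap.toContinuousLinearMap L'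
  have hn : (∞ : WithTop ℕ∞) ≠ 0 := by simp
  -- An affine section to first order: `f ∘ a` has derivative the identity, and precomposing `a`
  -- with a local inverse of `f ∘ a` gives an exact section.
  set a : F → E := fun y => z₀ + L (y - f z₀)
  have ha : ContDiff ℝ ∞ a := contDiff_const.add (L.contDiff.comp (contDiff_id.sub contDiff_const))
  have ha₀ : a (f z₀) = z₀ := by simp [a]
  have had : HasFDerivAt a L (f z₀) := by
    have := (L.hasFDerivAt.comp (f z₀) ((hasFDerivAt_id (f z₀)).sub_const (f z₀))).const_add z₀
    rwa [ContinuousLinearMap.comp_id] at this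
  have hH : ContDiffAt ℝ ∞ (f ∘ a) (f z₀) :=
    ContDiffAt.comp _ (by rwa [ha₀]) ha.contDiffAt
  have hd : HasFDerivAt (f ∘ a) (ContinuousLinearMap.id ℝ F) (f z₀) := by
    have h1 : HasFDerivAt f (fderiv ℝ f z₀) (a (f z₀)) := by
      rw [ha₀]; exact (hf.differentiableAt hn).hasFDerivAt
    have h2 := h1.comp (f z₀) had
    convert h2 using 1
    ext v
    exact (LinearMap.congr_fun hL' v).symm
  obtain ⟨K, hK, hK₀, -, hK₁⟩ := exists_contDiffAt_leftInverse_of_hasFDerivAt_id hH hd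
  simp only [Function.comp_apply, ha₀] at hK hK₀ hK₁
  exact ⟨a ∘ K, ha.contDiffAt.comp _ hK, by simp [hK₀, ha₀], hK₁⟩

/-- The infinitesimal generator of a family of transformations is smooth. -/
theorem contDiffAt_generator {Q : E × ℝ → E} {q₀ : E} (hQ : ContDiffAt ℝ ∞ Q (q₀, 0)) :
    ContDiffAt ℝ 1 (fun q => fderiv ℝ Q (q, 0) (0, 1)) q₀ := by
  have h1 : ContDiffAt ℝ 1 (fderiv ℝ Q) (q₀, 0) := hQ.fderiv_right (by norm_cast)
  have h2 : ContDiffAt ℝ 1 (fun q : E => ((q, 0) : E × ℝ)) q₀ := contDiffAt_id.prodMk contDiffAt_const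
  exact (h1.comp q₀ h2).clm_apply contDiffAt_const

theorem hasDerivAt_of_generator {Q : E × ℝ → F} {q : E} (hQ : DifferentiableAt ℝ Q (q, 0)) :
    HasDerivAt (fun τ : ℝ => Q (q, τ)) (fderiv ℝ Q (q, 0) (0, 1)) 0 := by
  have h2 : HasDerivAt (fun τ : ℝ => ((q, τ) : E × ℝ)) (0, 1) 0 :=
    (hasDerivAt_const _ _).prodMk (hasDerivAt_id _)
  exact hQ.hasFDerivAt.comp_hasDerivAt (0 : ℝ) h2

theorem _root_.ContDiffAt.eventually_differentiableAt {f : E → F} {a : E}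
    (hf : ContDiffAt ℝ ∞ f a) : ∀ᶠ x in 𝓝 a, DifferentiableAt ℝ f x := by
  have h1 : ContDiffAt ℝ 1 f a := hf.of_le (by norm_cast)
  filter_upwards [h1.eventually (by simp)] with x hx using hx.differentiableAt (by simp)

/-- Let `W` and `Q` be families of transformations starting at the identity, intertwined by `o` along
a fibre of `T`, where `W` preserves the fibres of `T`. If `o` is injective on the fibre and the
generator of `Q` vanishes at `o y₀`, then the generator of `W` vanishes at `y₀`. -/
theorem generator_eq_zero [CompleteSpace E] {W : E × ℝ → E} {Q : F × ℝ → F} {T : E → G} {o : E → F}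
    {y₀ : E} (hW : ContDiffAt ℝ ∞ W (y₀, 0)) (hQ : ContDiffAt ℝ ∞ Q (o y₀, 0))
    (hT : ContDiffAt ℝ ∞ T y₀) (ho : ContDiffAt ℝ ∞ o y₀)
    (hW₀ : ∀ᶠ y in 𝓝 y₀, W (y, 0) = y)
    (hTW : ∀ᶠ z in 𝓝 ((y₀, 0) : E × ℝ), T (W z) = T z.1)
    (hoW : ∀ᶠ z in 𝓝 ((y₀, 0) : E × ℝ), T z.1 = T y₀ → o (W z) = Q (o z.1, z.2))
    (hinj : ∀ᶠ y in 𝓝 y₀, T y = T y₀ → o y = o y₀ → y = y₀)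
    (hgen : fderiv ℝ Q (o y₀, 0) (0, 1) = 0) : fderiv ℝ W (y₀, 0) (0, 1) = 0 := by
  have hn : (∞ : WithTop ℕ∞) ≠ 0 := by simp
  set u : E → E := fun y => fderiv ℝ W (y, 0) (0, 1)
  set uQ : F → F := fun q => fderiv ℝ Q (q, 0) (0, 1)
  -- `c` is an integral curve of the generator `u` of `W` through `y₀`. The aim is to show that it
  -- is constant.
  obtain ⟨c, hc₀, ε, hε, hc⟩ := (contDiffAt_generator hW).exists_forall_mem_closedBall_exists_eq_forall_mem_Ioo_hasDerivAt₀ 0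
  have hcd : ∀ᶠ t in 𝓝 (0 : ℝ), HasDerivAt c (u (c t)) t := by
    filter_upwards [Ioo_mem_nhds (by linarith : (0 : ℝ) - ε < 0) (by linarith : (0 : ℝ) < 0 + ε)]
      with t ht using hc t ht
  have hcc : Tendsto c (𝓝 0) (𝓝 y₀) := by
    have := hcd.self_of_nhds.continuousAt.tendsto
    rwa [hc₀] at this
  have slice : Tendsto (fun y : E => ((y, 0) : E × ℝ)) (𝓝 y₀) (𝓝 (y₀, 0)) :=
    (Continuous.prodMk_left (0 : ℝ)).continuousAt
  have hWd := slice.eventually hW.eventually_differentiableAt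
  have hTd := hT.eventually_differentiableAt
  have hod := ho.eventually_differentiableAt
  have hWu : ∀ᶠ y in 𝓝 y₀, HasDerivAt (fun τ => W (y, τ)) (u y) 0 := by
    filter_upwards [hWd] with y hy using hasDerivAt_of_generator hy
  have hTu : ∀ᶠ y in 𝓝 y₀, fderiv ℝ T y (u y) = 0 := by
    filter_upwards [hWu, hTd, hW₀, slice.eventually hTW.eventually_nhds] with y h1 h2 h3 h4
    have h5 : HasFDerivAt T (fderiv ℝ T y) (W (y, 0)) := by rw [h3]; exact h2.hasFDerivAt
    have h6 := h5.comp_hasDerivAt (0 : ℝ) h1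
    refine h6.unique ((hasDerivAt_const (0 : ℝ) (T y)).congr_of_eventuallyEq ?_)
    exact (Continuous.prodMk_right y).continuousAt.eventually h4
  have hTc : ∀ᶠ t in 𝓝 (0 : ℝ), T (c t) = T y₀ := by
    have h1 : ∀ᶠ t in 𝓝 (0 : ℝ), HasDerivAt (T ∘ c) 0 t := by
      filter_upwards [hcd, hcc.eventually hTu, hcc.eventually hTd] with t h1 h2 h3
      rw [← h2]
      exact h3.hasFDerivAt.comp_hasDerivAt t h1
    obtain ⟨δ, hδ, h2⟩ := Metric.eventually_nhds_iff_ball.1 h1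
    filter_upwards [Metric.ball_mem_nhds (0 : ℝ) hδ] with t ht
    have := (convex_ball (0 : ℝ) δ).is_const_of_fderivWithin_eq_zero (𝕜 := ℝ) (f := T ∘ c)
      (fun x hx => (h2 x hx).differentiableAt.differentiableWithinAt)
      (fun x hx => by
        rw [fderivWithin_of_isOpen Metric.isOpen_ball hx]
        ext
        simp [(h2 x hx).deriv]) ht (Metric.mem_ball_self hδ)
    simpa [hc₀] using this
  have hoc : Tendsto (o ∘ c) (𝓝 0) (𝓝 (o y₀)) := ho.continuousAt.tendsto.comp hcc
  have slice' : Tendsto (fun y : F => ((y, 0) : F × ℝ)) (𝓝 (o y₀)) (𝓝 (o y₀, 0)) :=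
    (Continuous.prodMk_left (0 : ℝ)).continuousAt
  -- Differentiating `o (W (y, τ)) = Q (o y, τ)` at `τ = 0` shows that `o` relates the two
  -- generators. This identity holds only on the fibre of `T` through `y₀`, which is why `c` was
  -- first shown to stay in it.
  have hou : ∀ᶠ t in 𝓝 (0 : ℝ), HasDerivAt (o ∘ c) (uQ (o (c t))) t := by
    filter_upwards [hcd, hcc.eventually hWu, hcc.eventually hod, hcc.eventually hW₀, hTc,
      hcc.eventually (slice.eventually hoW.eventually_nhds),
      hoc.eventually (slice'.eventually hQ.eventually_differentiableAt)] with t h1 h2 h3 h4 h5 h6 h7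
    have h8 : HasFDerivAt o (fderiv ℝ o (c t)) (W (c t, 0)) := by rw [h4]; exact h3.hasFDerivAt
    have h9 := h8.comp_hasDerivAt (0 : ℝ) h2
    have h10 : HasDerivAt (fun τ => Q (o (c t), τ)) (uQ (o (c t))) 0 := hasDerivAt_of_generator h7
    have h11 : fderiv ℝ o (c t) (u (c t)) = uQ (o (c t)) := by
      refine h9.unique (h10.congr_of_eventuallyEq ?_)
      filter_upwards [(Continuous.prodMk_right (c t)).continuousAt.eventually h6] with τ hτ
      exact hτ h5
    rw [← h11]
    exact h3.hasFDerivAt.comp_hasDerivAt t h1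
  obtain ⟨K, s, hs, hK⟩ := (contDiffAt_generator hQ).exists_lipschitzOnWith
  -- The constant curve at the zero `o y₀` of `uQ` is another integral curve with the same initial
  -- value, and `uQ` is `C¹`, hence locally Lipschitz.
  have heq : o ∘ c =ᶠ[𝓝 0] fun _ => o y₀ := by
    refine ODE_solution_unique_of_eventually (v := fun _ => uQ) (s := fun _ => s) (K := K)
      (Eventually.of_forall fun _ => hK) ?_ ?_ (by simp [hc₀])
    · filter_upwards [hou, hoc.eventually hs] with t h1 h2 using ⟨h1, h2⟩
    · refine Eventually.of_forall fun t => ⟨?_, mem_of_mem_nhds hs⟩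
      simp only [uQ, hgen]
      exact hasDerivAt_const _ _
  have hcy : c =ᶠ[𝓝 0] fun _ => y₀ := by
    filter_upwards [heq, hTc, hcc.eventually hinj] with t h1 h2 h3 using h3 h2 h1
  have h1 := hcd.self_of_nhds
  rw [hc₀] at h1
  exact h1.unique ((hasDerivAt_const (0 : ℝ) y₀).congr_of_eventuallyEq hcy)

end Analysis

/-! ### Velocities of curves, fibre projections of submersions, and the manifold versions of the
calculus lemmas. -/

section Velocity

variable {E E' E'' H H' H'' M M' M'' : Type*}
  [NormedAddCommGroup E] [NormedSpace ℝ E] [TopologicalSpace H] {I : ModelWithCorners ℝ E H}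
  [TopologicalSpace M] [ChartedSpace H M]
  [NormedAddCommGroup E'] [NormedSpace ℝ E'] [TopologicalSpace H'] {I' : ModelWithCorners ℝ E' H'}
  [TopologicalSpace M'] [ChartedSpace H' M']
  [NormedAddCommGroup E''] [NormedSpace ℝ E''] [TopologicalSpace H'']
  {I'' : ModelWithCorners ℝ E'' H''} [TopologicalSpace M''] [ChartedSpace H'' M'']

variable (I) in
/-- The curve `γ` passes through `x` at time `0` with velocity `v`. -/
def HasVelocity (γ : ℝ → M) (x : M) (v : TangentSpace I x) : Prop :=
  γ 0 = x ∧ ContinuousAt γ 0 ∧ HasDerivAt (F := E) (extChartAt I x ∘ γ) v 0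

namespace HasVelocity

variable {γ γ' : ℝ → M} {x : M} {v w : TangentSpace I x}

theorem tendsto (h : HasVelocity I γ x v) : Tendsto γ (𝓝 0) (𝓝 x) := by
  have := h.2.1.tendsto
  rwa [h.1] at this

theorem unique (h : HasVelocity I γ x v) (h' : HasVelocity I γ x w) : v = w :=
  HasDerivAt.unique (F := E) h.2.2 h'.2.2

theorem of_eq (h : HasVelocity I γ x v) {y : M} (e : x = y) : HasVelocity I γ y (v : E) := by
  subst e
  exact h

theorem congr (h : HasVelocity I γ x v) (hγ : γ' =ᶠ[𝓝 0] γ) : HasVelocity I γ' x v := by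
  refine ⟨hγ.eq_of_nhds.trans h.1, h.2.1.congr hγ.symm, ?_⟩
  exact HasDerivAt.congr_of_eventuallyEq (F := E) h.2.2 (hγ.fun_comp _)

theorem const (x : M) : HasVelocity I (fun _ => x) x 0 :=
  ⟨rfl, continuousAt_const, hasDerivAt_const (F := E) 0 _⟩

/-- The chain rule for a map differentiable within a set containing the curve. -/
theorem comp_within (h : HasVelocity I γ x v) {f : M → M'} {s : Set M}
    {A : TangentSpace I x →L[ℝ] TangentSpace I' (f x)} (hf : HasMFDerivWithinAt I I' f s x A)
    (hs : ∀ᶠ t in 𝓝 0, γ t ∈ s) : HasVelocity I' (f ∘ γ) (f x) (A v) := by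
  obtain ⟨h0, hc, hd⟩ := h
  have htend : Tendsto γ (𝓝 0) (𝓝[s] x) := by
    refine tendsto_nhdsWithin_iff.2 ⟨?_, hs⟩
    have := hc.tendsto
    rwa [h0] at this
  have hsrc : ∀ᶠ t in 𝓝 (0 : ℝ), γ t ∈ (extChartAt I x).source :=
    (htend.mono_right nhdsWithin_le_nhds).eventually (extChartAt_source_mem_nhds x)
  refine ⟨by simp [h0], ?_, ?_⟩
  · have := hf.1.tendsto.comp htend
    rw [← h0] at this
    exact this
  · have h1 : HasFDerivWithinAt (writtenInExtChartAt I I' x f) (A : E →L[ℝ] E')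
        ((extChartAt I x).symm ⁻¹' s ∩ range I) ((extChartAt I x ∘ γ) 0) := by
      simp only [Function.comp_apply, h0]
      exact hf.2
    -- The curve stays in the set, so any derivative within the set computes its velocity; no unique
    -- differentiability is needed.
    have hmaps : ∀ᶠ t in 𝓝 (0 : ℝ),
        (extChartAt I x ∘ γ) t ∈ (extChartAt I x).symm ⁻¹' s ∩ range I := by
      filter_upwards [hsrc, hs] with t ht hts
      refine ⟨?_, extChartAt_target_subset_range x ((extChartAt I x).map_source ht)⟩
      rw [mem_preimage, Function.comp_apply, (extChartAt I x).left_inv ht]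
      exact hts
    have h2 := HasFDerivWithinAt.comp_hasDerivAt (0 : ℝ) h1 hd hmaps
    refine HasDerivAt.congr_of_eventuallyEq (F := E') h2 ?_
    filter_upwards [hsrc] with t ht
    simp only [writtenInExtChartAt, Function.comp_apply, (extChartAt I x).left_inv ht]

theorem comp_hasMFDerivAt (h : HasVelocity I γ x v) {f : M → M'}
    {A : TangentSpace I x →L[ℝ] TangentSpace I' (f x)} (hf : HasMFDerivAt I I' f x A) :
    HasVelocity I' (f ∘ γ) (f x) (A v) :=
  h.comp_within (hasMFDerivWithinAt_univ.2 hf) (by simp)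

theorem comp (h : HasVelocity I γ x v) {f : M → M'} (hf : ContMDiffAt I I' ∞ f x) :
    HasVelocity I' (f ∘ γ) (f x) (mfderiv I I' f x v) :=
  h.comp_hasMFDerivAt (hf.mdifferentiableAt (by simp)).hasMFDerivAt

theorem prodMk (h : HasVelocity I γ x v) {δ : ℝ → M'} {y : M'} {u : TangentSpace I' y}
    (h' : HasVelocity I' δ y u) :
    HasVelocity (I.prod I') (fun t => (γ t, δ t)) (x, y) ((v, u) : E × E') := by
  refine ⟨by simp [h.1, h'.1], h.2.1.prodMk h'.2.1, ?_⟩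
  rw [extChartAt_prod]
  exact HasDerivAt.prodMk (F := E) (G := E') h.2.2 h'.2.2

theorem fst {γ : ℝ → M × M'} {z : M × M'} {v : TangentSpace (I.prod I') z}
    (h : HasVelocity (I.prod I') γ z v) :
    HasVelocity I (fun t => (γ t).1) z.1 (v : E × E').1 := by
  refine ⟨by simp [h.1], continuousAt_fst.comp h.2.1, ?_⟩
  have h2 := h.2.2
  rw [extChartAt_prod] at h2
  exact HasFDerivAt.comp_hasDerivAt (E := E) (F := E × E') (l := Prod.fst)
    (l' := ContinuousLinearMap.fst ℝ E E') (0 : ℝ) hasFDerivAt_fst h2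

theorem snd {γ : ℝ → M × M'} {z : M × M'} {v : TangentSpace (I.prod I') z}
    (h : HasVelocity (I.prod I') γ z v) :
    HasVelocity I' (fun t => (γ t).2) z.2 (v : E × E').2 := by
  refine ⟨by simp [h.1], continuousAt_snd.comp h.2.1, ?_⟩
  have h2 := h.2.2
  rw [extChartAt_prod] at h2
  exact HasFDerivAt.comp_hasDerivAt (E := E') (F := E × E') (l := Prod.snd)
    (l' := ContinuousLinearMap.snd ℝ E E') (0 : ℝ) hasFDerivAt_snd h2

end HasVelocity

/-- The coordinate line in the direction `v` has velocity `v`. -/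
theorem hasVelocity_line [I.Boundaryless] (x : M) (v : E) :
    HasVelocity I (fun t : ℝ => (extChartAt I x).symm (extChartAt I x x + t • v)) x v := by
  have hline : HasDerivAt (fun t : ℝ => extChartAt I x x + t • v) v 0 := by
    have := ((hasDerivAt_id (0 : ℝ)).smul_const v).const_add (extChartAt I x x)
    simpa using this
  have htend : Tendsto (fun t : ℝ => extChartAt I x x + t • v) (𝓝 0) (𝓝 (extChartAt I x x)) := by
    have := hline.continuousAt.tendsto
    simpa using this
  refine ⟨by simp, ?_, ?_⟩
  · have := (continuousAt_extChartAt_symm x).tendsto.comp htend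
    simpa [ContinuousAt, Function.comp_def] using this
  · refine HasDerivAt.congr_of_eventuallyEq (F := E) hline ?_
    filter_upwards [htend.eventually (extChartAt_target_mem_nhds x)] with t ht
    simp only [Function.comp_apply]
    exact (extChartAt I x).right_inv ht

/-- Every tangent vector is the velocity of a curve. -/
theorem exists_hasVelocity [I.Boundaryless] (x : M) (v : TangentSpace I x) :
    ∃ γ, HasVelocity I γ x v :=
  ⟨_, hasVelocity_line (E := E) x v⟩

theorem _root_.ContMDiffAt.contDiffAt_writtenInExtChartAt [I.Boundaryless] {f : M → M'} {x : M}
    (hf : ContMDiffAt I I' ∞ f x) :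
    ContDiffAt ℝ ∞ (writtenInExtChartAt I I' x f) (extChartAt I x x) := by
  have := (contMDiffAt_iff.1 hf).2
  rwa [I.range_eq_univ, contDiffWithinAt_univ] at this

theorem HasVelocity.comp_fderiv [I.Boundaryless] {γ : ℝ → M} {x : M} {v : E} (h : HasVelocity I γ x v)
    {f : M → M'} (hf : ContMDiffAt I I' ∞ f x) : HasVelocity I' (f ∘ γ) (f x)
      (fderiv ℝ (writtenInExtChartAt I I' x f) (extChartAt I x x) v) := by
  refine h.comp_hasMFDerivAt (f := f)
    (A := (fderiv ℝ (writtenInExtChartAt I I' x f) (extChartAt I x x) : E →L[ℝ] E'))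
    ⟨hf.continuousAt, ?_⟩
  exact (hf.contDiffAt_writtenInExtChartAt.differentiableAt (by simp)).hasFDerivAt.hasFDerivWithinAt

/-- A smooth map `ρ` that moves a point `y` close to `x` to the fibre of `f` over a given point close
to `f x`, fixing `y` if it already is in that fibre. -/
structure IsFibreProjectionAt (I : ModelWithCorners ℝ E H) (I' : ModelWithCorners ℝ E' H')
    (f : M → M') (x : M) (ρ : M × M' → M) : Prop where
  smooth : ContMDiffAt (I.prod I') I ∞ ρ (x, f x)
  apply_self : ∀ᶠ y in 𝓝 x, ρ (y, f y) = y
  map_apply : ∀ᶠ z in 𝓝 (x, f x), f (ρ z) = z.2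

/-- By the chain rule the velocity of `ρ (γ, δ)` depends only on those of `γ` and `δ`. Replacing `δ`
by `f ∘ γ`, which has the same velocity, gives `ρ (γ, f ∘ γ) = γ`. So a curve can be pushed into a
prescribed family of fibres without changing its velocity. -/
theorem IsFibreProjectionAt.hasVelocity {f : M → M'} {x : M} {ρ : M × M' → M}
    (hρ : IsFibreProjectionAt I I' f x ρ) (hf : ContMDiffAt I I' ∞ f x) {γ : ℝ → M} {δ : ℝ → M'}
    {v : TangentSpace I x} (hγ : HasVelocity I γ x v)
    (hδ : HasVelocity I' δ (f x) (mfderiv I I' f x v)) :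
    HasVelocity I (fun t => ρ (γ t, δ t)) x v := by
  have e : ρ (x, f x) = x := hρ.apply_self.self_of_nhds
  have h1 := ((hγ.prodMk (hγ.comp hf)).comp hρ.smooth).of_eq e
  have h2 := ((hγ.prodMk hδ).comp hρ.smooth).of_eq e
  have h3 : HasVelocity I (ρ ∘ fun t => (γ t, (f ∘ γ) t)) x v :=
    hγ.congr (hγ.tendsto.eventually hρ.apply_self)
  rw [h1.unique h3] at h2
  exact h2

/-- Submersions have fibre projections. -/
theorem _root_.Manifold.IsSubmersionAt.exists_isFibreProjectionAt [I.Boundaryless]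
    [IsManifold I ∞ M] [IsManifold I' ∞ M'] {f : M → M'} {x : M} (hf : Manifold.IsSubmersionAt I I' ∞ f x) :
    ∃ ρ, IsFibreProjectionAt I I' f x ρ := by
  set φ := hf.domChart.extend I with hφ
  set ψ := hf.codChart.extend I' with hψ
  have hφs : φ.source ∈ 𝓝 x := hf.domChart.extend_source_mem_nhds hf.mem_domChart_source
  have hψs : ψ.source ∈ 𝓝 (f x) := hf.codChart.extend_source_mem_nhds hf.mem_codChart_source
  have hφx : x ∈ φ.source := mem_of_mem_nhds hφs
  have hfac : ∀ y ∈ φ.source, ψ (f y) = (hf.equiv (φ y)).1 := fun y hy => by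
    have h := hf.writtenInCharts (φ.map_source hy)
    simp only [Function.comp_apply] at h
    rwa [φ.left_inv hy] at h
  -- In charts adapted to the submersion `f` is a linear projection. `G` keeps the complementary
  -- coordinate of `z.1` and overwrites the projected one by the coordinates of `z.2`.
  let G : M × M' → E := fun z => hf.equiv.symm (ψ z.2, (hf.equiv (φ z.1)).2)
  have hGx : ∀ y ∈ φ.source, G (y, f y) = φ y := fun y hy => by
    simp [G, hfac y hy]
  have hφc : ContMDiffAt I 𝓘(ℝ, E) ∞ φ x :=
    hf.domChart.contMDiffAt_extend hf.domChart_mem_maximalAtlas hf.mem_domChart_source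
  have hψc : ContMDiffAt I' 𝓘(ℝ, E') ∞ ψ (f x) :=
    hf.codChart.contMDiffAt_extend hf.codChart_mem_maximalAtlas hf.mem_codChart_source
  have hG : ContMDiffAt (I.prod I') 𝓘(ℝ, E) ∞ G (x, f x) := by
    have h1 : ContMDiffAt (I.prod I') 𝓘(ℝ, E') ∞ (fun z : M × M' => ψ z.2) (x, f x) :=
      ContMDiffAt.comp (x, f x) (g := ψ) hψc contMDiffAt_snd
    have h2 : ContMDiffAt (I.prod I') 𝓘(ℝ, E) ∞ (fun z : M × M' => φ z.1) (x, f x) :=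
      ContMDiffAt.comp (x, f x) (g := φ) hφc contMDiffAt_fst
    have h3 : ContMDiffAt (I.prod I') 𝓘(ℝ, hf.complement) ∞
        (fun z : M × M' => (hf.equiv (φ z.1)).2) (x, f x) :=
      ContMDiffAt.comp (x, f x) (g := fun e : E => (hf.equiv e).2)
        (contDiff_snd.comp hf.equiv.contDiff).contMDiff.contMDiffAt h2
    exact ContMDiffAt.comp (x, f x) (g := hf.equiv.symm)
      hf.equiv.symm.contDiff.contMDiff.contMDiffAt (h1.prodMk_space h3)
  have hφt : φ.target ∈ 𝓝 (φ x) := 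
    hf.domChart.isOpen_extend_target.mem_nhds (φ.map_source hφx)
  have hsymm : ContMDiffAt 𝓘(ℝ, E) I ∞ φ.symm (G (x, f x)) := by
    rw [hGx x hφx]
    exact (contMDiffOn_extend_symm hf.domChart_mem_maximalAtlas).contMDiffAt (by
      have := hf.domChart.extend_image_target_mem_nhds (I := I) hf.mem_domChart_source
      rwa [I.range_eq_univ, nhdsWithin_univ] at this)
  refine ⟨fun z => φ.symm (G z), ContMDiffAt.comp (x, f x) hsymm hG, ?_, ?_⟩
  · filter_upwards [hφs] with y hy
    rw [hGx y hy, φ.left_inv hy]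
  · have hGt : ∀ᶠ z in 𝓝 (x, f x), G z ∈ φ.target := by
      refine hG.continuousAt.eventually ?_
      rw [hGx x hφx]
      exact hφt
    filter_upwards [hGt, continuousAt_snd.eventually hψs] with z hz hz2
    have h1 := hf.writtenInCharts hz
    simp only [Function.comp_apply] at h1
    have h2 : ψ (f (φ.symm (G z))) = ψ z.2 := by
      rw [h1]; simp [G]
    refine ψ.injOn ?_ hz2 h2
    have h3 : φ.symm (G z) ∈ hf.domChart.source := by
      have := φ.map_target hz
      rwa [hφ, OpenPartialHomeomorph.extend_source] at this
    rw [hψ, OpenPartialHomeomorph.extend_source]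
    exact hf.source_subset_preimage_source h3

/-- An immersion of a smooth local retract has a smooth local left inverse. -/
theorem exists_contMDiffAt_leftInverse [I.Boundaryless]
    [IsManifold I ∞ M] [IsManifold I' ∞ M'] [CompleteSpace E] [FiniteDimensional ℝ E']
    {r : M → M} {f : M → M'} {z₀ : M}
    (hr : ContMDiffAt I I ∞ r z₀) (hf : ContMDiffAt I I' ∞ f z₀) (hr₀ : r z₀ = z₀)
    (hker : ∀ γ (v : TangentSpace I z₀), HasVelocity I γ z₀ v → HasVelocity I' (f ∘ γ) (f z₀) 0 →
      HasVelocity I (r ∘ γ) z₀ 0) :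
    ∃ k : M' → M, ContMDiffAt I' I ∞ k (f z₀) ∧ ∀ᶠ z in 𝓝 z₀, r z = z → k (f z) = z := by
  have hr' : writtenInExtChartAt I I z₀ r (extChartAt I z₀ z₀) = extChartAt I z₀ z₀ := by
    simp only [writtenInExtChartAt, Function.comp_apply, extChartAt_to_inv, hr₀]
  have hf' : writtenInExtChartAt I I' z₀ f (extChartAt I z₀ z₀) = extChartAt I' (f z₀) (f z₀) := by
    simp only [writtenInExtChartAt, Function.comp_apply, extChartAt_to_inv]
  obtain ⟨k, hk, hk₀, hkz⟩ := exists_contDiffAt_leftInverse hr.contDiffAt_writtenInExtChartAt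
    hf.contDiffAt_writtenInExtChartAt hr' (fun v hv => by
      obtain ⟨γ, hγ⟩ := exists_hasVelocity (I := I) z₀ v
      have h1 := hγ.comp_fderiv hf
      rw [hv] at h1
      exact ((hγ.comp_fderiv hr).of_eq hr₀).unique (hker γ v hγ h1))
  rw [hf'] at hk hk₀
  refine ⟨fun y => (extChartAt I z₀).symm (k (extChartAt I' (f z₀) y)), ?_, ?_⟩
  · have h1 : ContMDiffAt 𝓘(ℝ, E) I ∞ (extChartAt I z₀).symm (k (extChartAt I' (f z₀) (f z₀))) := by
      rw [hk₀]
      exact (contMDiffOn_extChartAt_symm z₀).contMDiffAt (extChartAt_target_mem_nhds z₀)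
    exact h1.comp (f z₀) (hk.contMDiffAt.comp (f z₀) contMDiffAt_extChartAt)
  · filter_upwards [(continuousAt_extChartAt (I := I) z₀).eventually hkz,
      extChartAt_source_mem_nhds (I := I) z₀] with z h1 h2 h4
    have h5 : writtenInExtChartAt I I z₀ r (extChartAt I z₀ z) = extChartAt I z₀ z := by
      simp only [writtenInExtChartAt, Function.comp_apply, (extChartAt I z₀).left_inv h2, h4, hr₀]
    have h6 := h1 h5
    simp only [writtenInExtChartAt, Function.comp_apply, (extChartAt I z₀).left_inv h2] at h6
    rw [h6, (extChartAt I z₀).left_inv h2]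

/-- A map with surjective derivative has a smooth local section. -/
theorem exists_contMDiffAt_section [I.Boundaryless] [IsManifold I ∞ M] [IsManifold I' ∞ M']
    [FiniteDimensional ℝ E'] {f : M → M'} {z₀ : M} (hf : ContMDiffAt I I' ∞ f z₀)
    (hsurj : ∀ u : TangentSpace I' (f z₀), ∃ γ, ∃ v : TangentSpace I z₀,
      HasVelocity I γ z₀ v ∧ HasVelocity I' (f ∘ γ) (f z₀) u) :
    ∃ k : M' → M, ContMDiffAt I' I ∞ k (f z₀) ∧ k (f z₀) = z₀ ∧
      ∀ᶠ y in 𝓝 (f z₀), f (k y) = y := by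
  have : CompleteSpace E' := FiniteDimensional.complete ℝ E'
  have hf' : writtenInExtChartAt I I' z₀ f (extChartAt I z₀ z₀) = extChartAt I' (f z₀) (f z₀) := by
    simp only [writtenInExtChartAt, Function.comp_apply, extChartAt_to_inv]
  obtain ⟨k, hk, hk₀, hky⟩ := exists_contDiffAt_section hf.contDiffAt_writtenInExtChartAt
    (fun u => by
      obtain ⟨γ, v, hγ, hu⟩ := hsurj u
      exact ⟨v, (hγ.comp_fderiv hf).unique hu⟩)
  rw [hf'] at hk hk₀ hky
  have h1 : ContMDiffAt 𝓘(ℝ, E) I ∞ (extChartAt I z₀).symm (k (extChartAt I' (f z₀) (f z₀))) := by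
    rw [hk₀]
    exact (contMDiffOn_extChartAt_symm z₀).contMDiffAt (extChartAt_target_mem_nhds z₀)
  have h2 : ContMDiffAt I' I ∞ (fun y => (extChartAt I z₀).symm (k (extChartAt I' (f z₀) y)))
      (f z₀) := h1.comp (f z₀) (hk.contMDiffAt.comp (f z₀) contMDiffAt_extChartAt)
  have h3 : (extChartAt I z₀).symm (k (extChartAt I' (f z₀) (f z₀))) = z₀ := by
    rw [hk₀, extChartAt_to_inv]
  refine ⟨_, h2, h3, ?_⟩
  have h4 := h2.continuousAt
  rw [ContinuousAt, h3] at h4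
  filter_upwards [(continuousAt_extChartAt (I := I') (f z₀)).eventually hky,
    extChartAt_source_mem_nhds (I := I') (f z₀),
    (hf.continuousAt.tendsto.comp h4).eventually (extChartAt_source_mem_nhds (I := I') (f z₀))]
    with y h5 h6 h7
  exact (extChartAt I' (f z₀)).injOn h7 h6 h5

/-- Let `W` and `Q` be smooth families of transformations, `W` starting at the identity, intertwined
by `o` along a fibre of `T`, where `W` preserves the fibres of `T`. If `o` is injective on the fibre and
the generator of `Q` vanishes at `o m₀`, then the generator of `W` vanishes at `m₀`. -/
theorem velocity_eq_zero_of_intertwining [I.Boundaryless] [I'.Boundaryless] [CompleteSpace E]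
    {W : M × ℝ → M} {Q : M' × ℝ → M'} {T : M → M''} {o : M → M'} {m₀ : M}
    (hW : ContMDiffAt (I.prod 𝓘(ℝ, ℝ)) I ∞ W (m₀, 0))
    (hQ : ContMDiffAt (I'.prod 𝓘(ℝ, ℝ)) I' ∞ Q (o m₀, 0))
    (hT : ContMDiffAt I I'' ∞ T m₀) (ho : ContMDiffAt I I' ∞ o m₀)
    (hW₀ : ∀ᶠ m in 𝓝 m₀, W (m, 0) = m)
    (hTW : ∀ᶠ z in 𝓝 ((m₀, 0) : M × ℝ), T (W z) = T z.1)
    (hoW : ∀ᶠ z in 𝓝 ((m₀, 0) : M × ℝ), T z.1 = T m₀ → o (W z) = Q (o z.1, z.2))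
    (hinj : ∀ᶠ m in 𝓝 m₀, T m = T m₀ → o m = o m₀ → m = m₀)
    (hgen : HasVelocity I' (fun τ => Q (o m₀, τ)) (o m₀) 0)
    {v : TangentSpace I m₀} (hv : HasVelocity I (fun τ => W (m₀, τ)) m₀ v) : v = 0 := by
  have hWm : W (m₀, 0) = m₀ := hW₀.self_of_nhds
  have hQo : Q (o m₀, 0) = o m₀ := hgen.1
  -- Both families start at the base points, so one chart at each of `m₀`, `o m₀` and `T m₀`
  -- suffices. The argument is local and uses no Hausdorff property.
  set φ := extChartAt I m₀ with hφ
  set ψ := extChartAt I' (o m₀) with hψ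
  set χ := extChartAt I'' (T m₀) with hχ
  have hφs : φ.source ∈ 𝓝 m₀ := extChartAt_source_mem_nhds m₀
  have hψs : ψ.source ∈ 𝓝 (o m₀) := extChartAt_source_mem_nhds (o m₀)
  have hχs : χ.source ∈ 𝓝 (T m₀) := extChartAt_source_mem_nhds (T m₀)
  have hφt : φ.target ∈ 𝓝 (φ m₀) := extChartAt_target_mem_nhds m₀
  have hφm : φ.symm (φ m₀) = m₀ := extChartAt_to_inv m₀
  have hψm : ψ.symm (ψ (o m₀)) = o m₀ := extChartAt_to_inv (o m₀)
  have hφc : Tendsto φ.symm (𝓝 (φ m₀)) (𝓝 m₀) := by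
    have := (continuousAt_extChartAt_symm (I := I) m₀).tendsto
    rwa [extChartAt_to_inv] at this
  have hφc2 : Tendsto (fun z : E × ℝ => (φ.symm z.1, z.2)) (𝓝 (φ m₀, 0)) (𝓝 (m₀, 0)) := by
    rw [nhds_prod_eq, nhds_prod_eq]
    exact (hφc.comp tendsto_fst).prodMk tendsto_snd
  have hW' : ContDiffAt ℝ ∞ (fun z : E × ℝ => φ (W (φ.symm z.1, z.2))) (φ m₀, 0) := by
    have h := hW.contDiffAt_writtenInExtChartAt
    simp only [writtenInExtChartAt, hWm, extChartAt_prod] at h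
    exact h
  have hQ' : ContDiffAt ℝ ∞ (fun z : E' × ℝ => ψ (Q (ψ.symm z.1, z.2))) (ψ (o m₀), 0) := by
    have h := hQ.contDiffAt_writtenInExtChartAt
    simp only [writtenInExtChartAt, hQo, extChartAt_prod] at h
    exact h
  have hT' : ContDiffAt ℝ ∞ (fun y => χ (T (φ.symm y))) (φ m₀) := hT.contDiffAt_writtenInExtChartAt
  have ho' : ContDiffAt ℝ ∞ (fun y => ψ (o (φ.symm y))) (φ m₀) := ho.contDiffAt_writtenInExtChartAt
  have hWc : Tendsto W (𝓝 (m₀, 0)) (𝓝 m₀) := by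
    have := hW.continuousAt.tendsto
    rwa [hWm] at this
  have key := generator_eq_zero (W := fun z : E × ℝ => φ (W (φ.symm z.1, z.2)))
    (Q := fun z : E' × ℝ => ψ (Q (ψ.symm z.1, z.2))) (T := fun y => χ (T (φ.symm y)))
    (o := fun y => ψ (o (φ.symm y))) (y₀ := φ m₀) hW' (by rw [hφm]; exact hQ') hT' ho'
    ?_ ?_ ?_ ?_ ?_
  · have h1 := hasDerivAt_of_generator (hW'.differentiableAt (by simp))
    rw [key] at h1
    simp only [hφm] at h1
    exact HasDerivAt.unique (F := E) hv.2.2 h1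
  · filter_upwards [hφc.eventually hW₀, hφt] with y h1 h2
    rw [h1, φ.right_inv h2]
  · filter_upwards [hφc2.eventually hTW, hφc2.eventually (hWc.eventually hφs)] with z h1 h2
    rw [φ.left_inv h2, h1]
  · have hfst : Tendsto Prod.fst (𝓝 ((m₀, 0) : M × ℝ)) (𝓝 m₀) := continuousAt_fst
    filter_upwards [hφc2.eventually hoW, hφc2.eventually (hWc.eventually hφs),
      hφc2.eventually (hfst.eventually (hT.continuousAt.eventually hχs)),
      hφc2.eventually (hfst.eventually (ho.continuousAt.eventually hψs))] with z h1 h2 h3 h4 h5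
    rw [hφm] at h5
    rw [φ.left_inv h2, ψ.left_inv h4, h1 (χ.injOn h3 (mem_of_mem_nhds hχs) h5)]
  · filter_upwards [hφc.eventually hinj, hφt, hφc.eventually (hT.continuousAt.eventually hχs),
      hφc.eventually (ho.continuousAt.eventually hψs)] with y h1 h2 h3 h4 h5 h6
    rw [hφm] at h5 h6
    rw [← h1 (χ.injOn h3 (mem_of_mem_nhds hχs) h5) (ψ.injOn h4 (mem_of_mem_nhds hψs) h6),
      φ.right_inv h2]
  · rw [hφm]
    have h1 := hasDerivAt_of_generator (hQ'.differentiableAt (by simp))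
    simp only [hψm] at h1
    exact HasDerivAt.unique (F := E') h1 hgen.2.2

end Velocity

/-! ### Smooth maps on fibre products and curves inside them. -/

section FibreProducts

variable {M N L K : SmoothManifold.{u}}

theorem IsSurjSubmersion.exists_isFibreProjectionAt {f : M → N} (hf : IsSurjSubmersion f) (x : M) :
    ∃ ρ, IsFibreProjectionAt (𝓡 M.dim) (𝓡 N.dim) f x ρ :=
  (hf.2.isSubmersionAt x).exists_isFibreProjectionAt

/-- The chain rule for a map of two variables defined on a subset. -/
theorem SmoothOn₂.hasVelocity {f : M → N → L} {s : Set (M × N)} (hf : SmoothOn₂ f s) {p : M} {q : N}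
    (hpq : (p, q) ∈ s) {γ : ℝ → M} {δ : ℝ → N} {v : Tan M p} {w : Tan N q}
    (hγ : HasVelocity (𝓡 M.dim) γ p v) (hδ : HasVelocity (𝓡 N.dim) δ q w)
    (hs : ∀ᶠ t in 𝓝 0, (γ t, δ t) ∈ s) :
    HasVelocity (𝓡 L.dim) (fun t => f (γ t) (δ t)) (f p q) (D₂ f s p q v w) :=
  (hγ.prodMk hδ).comp_within
    ((hf (p, q) hpq).mdifferentiableWithinAt (by simp)).hasMFDerivWithinAt hs

theorem SmoothOn₂.contMDiffWithinAt_comp {f : M → N → L} {s : Set (M × N)} (hf : SmoothOn₂ f s)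
    {E H A : Type*} [NormedAddCommGroup E] [NormedSpace ℝ E] [TopologicalSpace H]
    {I : ModelWithCorners ℝ E H} [TopologicalSpace A] [ChartedSpace H A] {a : A → M} {b : A → N}
    {t : Set A} {x : A} (ha : ContMDiffWithinAt I (𝓡 M.dim) ∞ a t x)
    (hb : ContMDiffWithinAt I (𝓡 N.dim) ∞ b t x) (hx : x ∈ t)
    (hs : ∀ᶠ y in 𝓝[t] x, (a y, b y) ∈ s) :
    ContMDiffWithinAt I (𝓡 L.dim) ∞ (fun y => f (a y) (b y)) t x := by
  have h1 := (hf (a x, b x) (hs.self_of_nhdsWithin hx)).comp x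
    ((ha.prodMk hb).mono (inter_subset_left (t := (fun y => (a y, b y)) ⁻¹' s)))
    fun y hy => hy.2
  exact h1.mono_of_mem_nhdsWithin (inter_mem self_mem_nhdsWithin hs)

theorem SmoothOn₂.contMDiffAt_comp {f : M → N → L} {s : Set (M × N)} (hf : SmoothOn₂ f s)
    {E H A : Type*} [NormedAddCommGroup E] [NormedSpace ℝ E] [TopologicalSpace H]
    {I : ModelWithCorners ℝ E H} [TopologicalSpace A] [ChartedSpace H A] {a : A → M} {b : A → N}
    {x : A} (ha : ContMDiffAt I (𝓡 M.dim) ∞ a x) (hb : ContMDiffAt I (𝓡 N.dim) ∞ b x)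
    (hs : ∀ᶠ y in 𝓝 x, (a y, b y) ∈ s) :
    ContMDiffAt I (𝓡 L.dim) ∞ (fun y => f (a y) (b y)) x :=
  hf.contMDiffWithinAt_comp (t := univ) ha hb (mem_univ x) (by rwa [nhdsWithin_univ])

/-- A pair of tangent vectors with the same image is tangent to the fibre product. -/
theorem IsSurjSubmersion.exists_hasVelocity {f : M → N} (hf : IsSurjSubmersion f) {g : L → N}
    (hg : ContMDiff (𝓡 L.dim) (𝓡 N.dim) ∞ g) {p : M} {q : L} (hpq : f p = g q) {v : Tan M p}
    {w : Tan L q} (hvw : D f p v = D g q w) :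
    ∃ γ δ, HasVelocity (𝓡 M.dim) γ p v ∧ HasVelocity (𝓡 L.dim) δ q w ∧
      ∀ᶠ t in 𝓝 0, f (γ t) = g (δ t) := by
  -- An arbitrary `γ` with velocity `v` is moved by `ρ` to lie over `g ∘ δ`. The hypothesis `hvw` is
  -- exactly what keeps its velocity equal to `v`.
  obtain ⟨ρ, hρ⟩ := hf.exists_isFibreProjectionAt p
  obtain ⟨γ, hγ⟩ := Pfaffian.exists_hasVelocity (I := 𝓡 M.dim) p v
  obtain ⟨δ, hδ⟩ := Pfaffian.exists_hasVelocity (I := 𝓡 L.dim) q w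
  have h1 : HasVelocity (𝓡 N.dim) (g ∘ δ) (f p) (D f p v) := by
    rw [hvw]
    exact (hδ.comp hg.contMDiffAt).of_eq hpq.symm
  have h2 : Tendsto (fun t => (γ t, (g ∘ δ) t)) (𝓝 0) (𝓝 (p, f p)) :=
    hγ.tendsto.prodMk_nhds h1.tendsto
  exact ⟨_, δ, hρ.hasVelocity hf.2.contMDiff.contMDiffAt hγ h1, hδ, h2.eventually hρ.map_apply⟩

/-- The curve `t ↦ ρ (p, δ t)` lifts any curve `δ` through `f p` to a curve through `p`. -/
theorem IsSurjSubmersion.surjective_D {f : M → N} (hf : IsSurjSubmersion f) (p : M) :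
    Function.Surjective (D f p) := by
  intro w
  obtain ⟨ρ, hρ⟩ := hf.exists_isFibreProjectionAt p
  obtain ⟨δ, hδ⟩ := Pfaffian.exists_hasVelocity (I := 𝓡 N.dim) (f p) w
  have e : ρ (p, f p) = p := hρ.apply_self.self_of_nhds
  have h1 := (((HasVelocity.const (I := 𝓡 M.dim) p).prodMk hδ).comp hρ.smooth).of_eq e
  refine ⟨_, (h1.comp (f := f) hf.2.contMDiff.contMDiffAt).unique (hδ.congr ?_)⟩
  have h2 : Tendsto (fun t => (p, δ t)) (𝓝 0) (𝓝 (p, f p)) :=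
    tendsto_const_nhds.prodMk_nhds hδ.tendsto
  exact h2.eventually hρ.map_apply

end FibreProducts

/-! ### Elementary groupoid algebra; the target map as a submersion. -/

namespace LieGroupoid

variable {X : SmoothManifold.{u}} (S : LieGroupoid X)

theorem eq_inv_of_mul_eq_unit {g h : S.Arr} (hgh : S.src g = S.tgt h)
    (e : S.mul g h = S.unit (S.tgt g)) : h = S.inv g := by
  have h1 : S.mul (S.inv g) (S.mul g h) = S.inv g := by
    rw [e, ← S.src_inv, S.mul_unit]
  rw [← S.mul_assoc _ _ _ (S.src_inv g) hgh, S.inv_mul, hgh, S.unit_mul] at h1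
  exact h1

theorem inv_inv (g : S.Arr) : S.inv (S.inv g) = g := by
  refine (S.eq_inv_of_mul_eq_unit (S.src_inv g) ?_).symm
  rw [S.inv_mul, S.tgt_inv]

theorem inv_mul_cancel_left {g h : S.Arr} (hgh : S.tgt g = S.tgt h) :
    S.mul g (S.mul (S.inv g) h) = h := by
  rw [← S.mul_assoc _ _ _ (S.tgt_inv g).symm ((S.src_inv g).trans hgh), S.mul_inv, hgh, S.unit_mul]

theorem inv_unit (x : X) : S.inv (S.unit x) = S.unit x := by
  refine (S.eq_inv_of_mul_eq_unit (by rw [S.src_unit, S.tgt_unit]) ?_).symm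
  have := S.mul_unit (S.unit x)
  rw [S.src_unit] at this
  rw [this, S.tgt_unit]

/-- Gauge data and isomorphisms are only assumed compatible with products; this is how their
compatibility with units is recovered. -/
theorem eq_unit_of_mul_self {g : S.Arr} (hg : S.src g = S.tgt g) (e : S.mul g g = g) :
    g = S.unit (S.tgt g) := by
  have h := S.mul_assoc (S.inv g) g g (S.src_inv g) hg
  rwa [e, S.inv_mul, hg, S.unit_mul] at h

theorem inv_mul_rev {g h : S.Arr} (hgh : S.src g = S.tgt h) :
    S.inv (S.mul g h) = S.mul (S.inv h) (S.inv g) := by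
  have e1 : S.src (S.inv h) = S.tgt (S.inv g) := by rw [S.src_inv, S.tgt_inv, hgh]
  have e2 : S.src h = S.tgt (S.inv h) := (S.tgt_inv h).symm
  refine (S.eq_inv_of_mul_eq_unit ?_ ?_).symm
  · rw [S.src_mul _ _ hgh, S.tgt_mul _ _ e1, S.tgt_inv]
  · rw [S.mul_assoc _ _ _ hgh (by rw [S.tgt_mul _ _ e1, S.tgt_inv]),
      ← S.mul_assoc h _ _ e2 e1, S.mul_inv, ← hgh, ← S.tgt_inv, S.unit_mul, S.mul_inv,
      S.tgt_mul _ _ hgh]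

/-- Inversion exchanges source and target, so a fibre projection of `src` is conjugated by `inv`. -/
theorem exists_isFibreProjectionAt_tgt (g : S.Arr) :
    ∃ ρ, IsFibreProjectionAt (𝓡 S.Arr.dim) (𝓡 X.dim) S.tgt g ρ := by
  obtain ⟨ρ, hρ⟩ := S.submersion_src.exists_isFibreProjectionAt (S.inv g)
  have e : S.src (S.inv g) = S.tgt g := S.src_inv g
  obtain ⟨h1, h2, h3⟩ := hρ
  rw [e] at h1 h3
  have hinv : Tendsto S.inv (𝓝 g) (𝓝 (S.inv g)) := S.inv.contMDiff.continuous.continuousAt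
  refine ⟨fun z => S.inv (ρ (S.inv z.1, z.2)), ?_, ?_, ?_⟩
  · have h4 : ContMDiffAt ((𝓡 S.Arr.dim).prod (𝓡 X.dim)) (𝓡 S.Arr.dim) ∞
        (fun z : S.Arr × X => S.inv z.1) (g, S.tgt g) :=
      S.inv.contMDiff.contMDiffAt.comp (g, S.tgt g) contMDiffAt_fst
    exact S.inv.contMDiff.contMDiffAt.comp (g, S.tgt g)
      (ContMDiffAt.comp (g, S.tgt g) (g := ρ) h1 (h4.prodMk contMDiffAt_snd))
  · filter_upwards [hinv.eventually h2] with y hy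
    rw [← S.src_inv y, hy, S.inv_inv]
  · have h4 : Tendsto (fun z : S.Arr × X => (S.inv z.1, z.2)) (𝓝 (g, S.tgt g))
        (𝓝 (S.inv g, S.tgt g)) := by
      rw [nhds_prod_eq, nhds_prod_eq]
      exact (hinv.comp tendsto_fst).prodMk tendsto_snd
    filter_upwards [h4.eventually h3] with z hz
    rw [S.tgt_inv, hz]

end LieGroupoid

/-! ### Free actions are infinitesimally free. -/

namespace IsRightPrincipal

variable {X P M : SmoothManifold.{u}} {S : LieGroupoid X} {μ : SmoothMap P X} {proj : SmoothMap P M}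
  {act : P → S.Arr → P}

/-- The infinitesimal action on a fibre of the target map is injective at units. -/
theorem eq_zero_of_D₂_act_unit_eq_zero (h : IsRightPrincipal S μ proj act) {p : P} {x : X}
    (hx : μ p = x) {α : Tan S.Arr (S.unit x)} (hα : D S.tgt (S.unit x) α = 0)
    (hact : D₂ act {z | μ z.1 = S.tgt z.2} p (S.unit x) 0 α = 0) : α = 0 := by
  obtain ⟨ρ, hρ⟩ := S.exists_isFibreProjectionAt_tgt (S.unit x)
  have hρs := hρ.smooth
  have hρm := hρ.map_apply
  rw [S.tgt_unit] at hρs hρm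
  have hρu : ρ (S.unit x, x) = S.unit x := by
    have := hρ.apply_self.self_of_nhds
    rwa [S.tgt_unit] at this
  have hunit : Tendsto S.unit (𝓝 x) (𝓝 (S.unit x)) := S.unit.contMDiff.continuous.continuousAt
  obtain ⟨α', hα'⟩ : ∃ α' : EuclideanSpace ℝ (Fin S.Arr.dim), α' = α := ⟨α, rfl⟩
  set φ := extChartAt (𝓡 S.Arr.dim) (S.unit x) with hφ
  -- Extends the direction `α` at one unit to all nearby units, by translating them in a chart. The
  -- targets are wrong in general; `e` below corrects this with `ρ`.
  let c : X × ℝ → S.Arr := fun z => φ.symm (φ (S.unit z.1) + z.2 • α')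
  have hc : ContMDiffAt ((𝓡 X.dim).prod 𝓘(ℝ, ℝ)) (𝓡 S.Arr.dim) ∞ c (x, 0) := by
    have h1 : ContMDiffAt ((𝓡 X.dim).prod 𝓘(ℝ, ℝ)) 𝓘(ℝ, EuclideanSpace ℝ (Fin S.Arr.dim)) ∞
        (fun z : X × ℝ => φ (S.unit z.1)) (x, 0) :=
      ContMDiffAt.comp (x, (0 : ℝ)) (g := φ) contMDiffAt_extChartAt
        (S.unit.contMDiff.contMDiffAt.comp (x, (0 : ℝ)) contMDiffAt_fst)
    have h2 : ContMDiffAt ((𝓡 X.dim).prod 𝓘(ℝ, ℝ)) 𝓘(ℝ, EuclideanSpace ℝ (Fin S.Arr.dim)) ∞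
        (fun z : X × ℝ => z.2 • α') (x, 0) := contMDiffAt_snd.smul contMDiffAt_const
    have h3 := h1.add h2
    refine ContMDiffAt.comp (x, (0 : ℝ)) (g := φ.symm) ?_ h3
    refine (contMDiffOn_extChartAt_symm _).contMDiffAt ?_
    simp only [zero_smul, add_zero]
    exact extChartAt_target_mem_nhds (I := 𝓡 S.Arr.dim) (S.unit x)
  have hc0 : ∀ᶠ y in 𝓝 x, c (y, 0) = S.unit y := by
    filter_upwards [hunit.eventually (extChartAt_source_mem_nhds (I := 𝓡 S.Arr.dim) (S.unit x))]
      with y hy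
    simp only [c, zero_smul, add_zero]
    exact φ.left_inv hy
  have hcv : HasVelocity (𝓡 S.Arr.dim) (fun τ => c (x, τ)) (S.unit x) α := by
    rw [← hα']
    exact hasVelocity_line _ _
  have hcx : c (x, 0) = S.unit x := hcv.1
  let e : X × ℝ → S.Arr := fun z => ρ (c z, z.1)
  have he : ContMDiffAt ((𝓡 X.dim).prod 𝓘(ℝ, ℝ)) (𝓡 S.Arr.dim) ∞ e (x, 0) :=
    ContMDiffAt.comp (x, (0 : ℝ)) (g := ρ) (by rw [hcx]; exact hρs) (hc.prodMk contMDiffAt_fst)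
  have he0 : ∀ᶠ y in 𝓝 x, e (y, 0) = S.unit y := by
    filter_upwards [hc0, hunit.eventually hρ.apply_self] with y h1 h2
    rw [S.tgt_unit] at h2
    simp only [e, h1, h2]
  have het : ∀ᶠ z in 𝓝 ((x, 0) : X × ℝ), S.tgt (e z) = z.1 := by
    have h1 : Tendsto (fun z : X × ℝ => (c z, z.1)) (𝓝 (x, 0)) (𝓝 (S.unit x, x)) := by
      have := hc.continuousAt.tendsto
      rw [hcx] at this
      exact this.prodMk_nhds continuousAt_fst
    exact h1.eventually hρm
  have hev : HasVelocity (𝓡 S.Arr.dim) (fun τ => e (x, τ)) (S.unit x) α := by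
    refine hρ.hasVelocity S.tgt.contMDiff.contMDiffAt hcv ?_
    have h1 : mfderiv (𝓡 S.Arr.dim) (𝓡 X.dim) S.tgt (S.unit x) α = 0 := hα
    rw [h1]
    exact (HasVelocity.const (I := 𝓡 X.dim) x).of_eq (S.tgt_unit x).symm
  have slice : Tendsto (fun τ : ℝ => (x, τ)) (𝓝 0) (𝓝 (x, 0)) :=
    (Continuous.prodMk_right x).continuousAt
  have hpair {N : SmoothManifold.{u}} (f : SmoothMap N X) {n : N} (hn : f n = x) :
      Tendsto (fun z : N × ℝ => (f z.1, z.2)) (𝓝 (n, 0)) (𝓝 (x, 0)) := by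
    have h1 : Tendsto f (𝓝 n) (𝓝 x) := hn ▸ f.contMDiff.continuous.continuousAt
    rw [nhds_prod_eq, nhds_prod_eq]
    exact (h1.comp tendsto_fst).prodMk tendsto_snd
  have hpairs {N : SmoothManifold.{u}} (f : SmoothMap N X) {n : N} (hn : f n = x) :
      ContMDiffAt ((𝓡 N.dim).prod 𝓘(ℝ, ℝ)) (𝓡 S.Arr.dim) ∞ (fun z : N × ℝ => e (f z.1, z.2))
        (n, 0) := by
    refine ContMDiffAt.comp (n, (0 : ℝ)) (g := e) (by simpa only [hn] using he) ?_
    exact (f.contMDiff.contMDiffAt.comp (n, (0 : ℝ)) contMDiffAt_fst).prodMk contMDiffAt_snd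
  have hsu := S.src_unit x
  have hpu : act p (S.unit x) = p := hx ▸ h.act_unit p
  have ho0 : act p (ρ (S.unit x, x)) = p := by rw [hρu, hpu]
  have hWs := hpair S.src hsu
  have hfst : Tendsto Prod.fst (𝓝 ((S.unit x, 0) : S.Arr × ℝ)) (𝓝 (S.unit x)) := continuousAt_fst
  have hW : ContMDiffAt ((𝓡 S.Arr.dim).prod 𝓘(ℝ, ℝ)) (𝓡 S.Arr.dim) ∞
      (fun z : S.Arr × ℝ => S.mul z.1 (e (S.src z.1, z.2))) (S.unit x, 0) :=
    S.smooth_mul.contMDiffAt_comp contMDiffAt_fst (hpairs S.src hsu)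
      ((hWs.eventually het).mono fun z hz => hz.symm)
  have hW₀ : ∀ᶠ g in 𝓝 (S.unit x), S.mul g (e (S.src g, 0)) = g := by
    have h1 : Tendsto S.src (𝓝 (S.unit x)) (𝓝 x) := by
      have := S.src.contMDiff.continuous.continuousAt (x := S.unit x)
      rwa [ContinuousAt, hsu] at this
    filter_upwards [h1.eventually he0] with g hg
    rw [hg, S.mul_unit]
  have hWc : Tendsto (fun z : S.Arr × ℝ => S.mul z.1 (e (S.src z.1, z.2))) (𝓝 (S.unit x, 0))
      (𝓝 (S.unit x)) := by
    have := hW.continuousAt.tendsto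
    simp only [hW₀.self_of_nhds] at this
    exact this
  -- `W` is right translation of arrows by `e`, which preserves targets; `Q` is the action of `e` on
  -- `P`. The orbit map `g ↦ p · g` intertwines them on the target fibre over `x`, and `ρ` extends
  -- it to a neighbourhood of the unit. The hypothesis `hact` says that the generator of `Q`
  -- vanishes at `p`, and freeness gives the injectivity.
  refine velocity_eq_zero_of_intertwining (I := 𝓡 S.Arr.dim) (I' := 𝓡 P.dim) (I'' := 𝓡 X.dim)
    (W := fun z => S.mul z.1 (e (S.src z.1, z.2)))
    (Q := fun z => act z.1 (e (μ z.1, z.2))) (T := S.tgt) (o := fun g => act p (ρ (g, x)))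
    (m₀ := S.unit x) hW ?_ S.tgt.contMDiff.contMDiffAt ?_ hW₀ ?_ ?_ ?_ ?_ ?_
  · rw [ho0]
    exact h.smooth_act.contMDiffAt_comp contMDiffAt_fst (hpairs μ hx)
      (((hpair μ hx).eventually het).mono fun z hz => hz.symm)
  · have h1 : ContMDiffAt (𝓡 S.Arr.dim) (𝓡 S.Arr.dim) ∞ (fun g : S.Arr => ρ (g, x)) (S.unit x) :=
      ContMDiffAt.comp (S.unit x) (g := ρ) hρs (contMDiffAt_id.prodMk contMDiffAt_const)
    refine h.smooth_act.contMDiffAt_comp contMDiffAt_const h1 ?_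
    have h2 : Tendsto (fun g : S.Arr => (g, x)) (𝓝 (S.unit x)) (𝓝 (S.unit x, x)) :=
      (Continuous.prodMk_left x).continuousAt
    exact (h2.eventually hρm).mono fun g hg => hx.trans hg.symm
  · filter_upwards [hWs.eventually het] with z hz
    exact S.tgt_mul _ _ hz.symm
  · filter_upwards [hWs.eventually het, hWc.eventually hρ.apply_self,
      hfst.eventually hρ.apply_self] with z h1 h2 h3 h4
    rw [S.tgt_unit] at h4
    rw [S.tgt_mul _ _ h1.symm, h4] at h2
    rw [h4] at h3
    rw [h2, h3, h.act_mul _ _ _ (hx.trans h4.symm) h1.symm, h.μ_act _ _ (hx.trans h4.symm)]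
  · filter_upwards [hρ.apply_self] with g h1 h2 h3
    rw [S.tgt_unit] at h2
    rw [h2] at h1
    rw [h1, ho0] at h3
    rw [h.free p g (hx.trans h2.symm) h3, hx]
  · have h1 := h.smooth_act.hasVelocity (p := p) (q := S.unit x) (hx.trans (S.tgt_unit x).symm)
      (HasVelocity.const (I := 𝓡 P.dim) p) hev
      ((slice.eventually het).mono fun τ hτ => hx.trans hτ.symm)
    rw [hact] at h1
    have h2 : HasVelocity (𝓡 P.dim) (fun τ => act p (e (μ p, τ))) p 0 := by
      rw [hx]
      exact h1.of_eq hpu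
    simp only [ho0]
    exact h2.of_eq ho0.symm
  · refine hev.congr ?_
    filter_upwards [slice.eventually het] with τ hτ
    rw [hsu]
    have := S.unit_mul (e (x, τ))
    rwa [hτ] at this

/-- The infinitesimal action on a fibre of the target map is injective. -/
theorem eq_zero_of_D₂_act_eq_zero (h : IsRightPrincipal S μ proj act) {p : P} {g : S.Arr}
    (hpg : μ p = S.tgt g) {w : Tan S.Arr g} (hw : D S.tgt g w = 0)
    (hact : D₂ act {z | μ z.1 = S.tgt z.2} p g 0 w = 0) : w = 0 := by
  obtain ⟨ρ, hρ⟩ := S.exists_isFibreProjectionAt_tgt g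
  obtain ⟨γ', hγ'⟩ := exists_hasVelocity (I := 𝓡 S.Arr.dim) g w
  have hc : HasVelocity (𝓡 X.dim) (fun _ => S.tgt g) (S.tgt g)
      (mfderiv (𝓡 S.Arr.dim) (𝓡 X.dim) S.tgt g w) := by
    have h1 : mfderiv (𝓡 S.Arr.dim) (𝓡 X.dim) S.tgt g w = 0 := hw
    rw [h1]
    exact HasVelocity.const _
  set γ : ℝ → S.Arr := fun t => ρ (γ' t, S.tgt g)
  have hγ : HasVelocity (𝓡 S.Arr.dim) γ g w :=
    hρ.hasVelocity S.tgt.contMDiff.contMDiffAt hγ' hc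
  have ht : ∀ᶠ t in 𝓝 0, S.tgt (γ t) = S.tgt g :=
    (hγ'.tendsto.prodMk_nhds tendsto_const_nhds).eventually hρ.map_apply
  have hsi : S.src (S.inv g) = S.tgt g := S.src_inv g
  have hpgμ : μ (act p g) = S.src g := h.μ_act p g hpg
  have hβ := (S.smooth_mul.hasVelocity (p := S.inv g) (q := g) hsi
    (HasVelocity.const (I := 𝓡 S.Arr.dim) (S.inv g)) hγ (ht.mono fun t e => hsi.trans e.symm)).of_eq
    (y := S.unit (μ (act p g))) (by rw [S.inv_mul, hpgμ])
  set α : Tan S.Arr (S.unit (μ (act p g))) := D₂ S.mul {z | S.src z.1 = S.tgt z.2} (S.inv g) g 0 w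
  have htβ : ∀ᶠ t in 𝓝 0, S.tgt (S.mul (S.inv g) (γ t)) = S.src g :=
    ht.mono fun t e => by rw [S.tgt_mul _ _ (hsi.trans e.symm), S.tgt_inv]
  -- Left translation by `g⁻¹` reduces to the case of a unit: `(p · g) · (g⁻¹ γ) = p · γ`, so `α`
  -- acts by zero at `p · g`.
  have hα0 : α = 0 := by
    refine h.eq_zero_of_D₂_act_unit_eq_zero (p := act p g) rfl ?_ ?_
    · refine (hβ.comp (f := S.tgt) S.tgt.contMDiff.contMDiffAt).unique ?_
      exact ((HasVelocity.const (I := 𝓡 X.dim) (S.src g)).congr htβ).of_eq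
        (by rw [S.tgt_unit, hpgμ])
    · have h1 := h.smooth_act.hasVelocity (p := act p g) (q := S.unit (μ (act p g)))
        (S.tgt_unit _).symm (HasVelocity.const (I := 𝓡 P.dim) (act p g)) hβ
        (htβ.mono fun t e => hpgμ.trans e.symm)
      have h2 := h.smooth_act.hasVelocity (p := p) (q := g) hpg
        (HasVelocity.const (I := 𝓡 P.dim) p) hγ (ht.mono fun t e => hpg.trans e.symm)
      rw [hact] at h2
      refine h1.unique ((h2.congr ?_).of_eq (h.act_unit _).symm)
      filter_upwards [ht] with t e
      rw [← h.act_mul _ _ _ hpg (by rw [S.tgt_mul _ _ (hsi.trans e.symm), S.tgt_inv]),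
        S.inv_mul_cancel_left e.symm]
  rw [hα0] at hβ
  -- Translating back, `γ = g (g⁻¹ γ)` is the image of a curve with velocity zero.
  have hm := S.smooth_mul.hasVelocity (p := g) (q := S.unit (μ (act p g)))
    (by rw [mem_ofPred, S.tgt_unit, hpgμ]) (HasVelocity.const (I := 𝓡 S.Arr.dim) g) hβ
    (htβ.mono fun t e => e.symm)
  have h0 : D₂ S.mul {z | S.src z.1 = S.tgt z.2} g (S.unit (μ (act p g))) 0 0 = 0 := by
    exact map_zero (mfderivWithin ((𝓡 S.Arr.dim).prod (𝓡 S.Arr.dim)) (𝓡 S.Arr.dim)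
      (fun z : S.Arr × S.Arr => S.mul z.1 z.2) {z | S.src z.1 = S.tgt z.2}
        (g, S.unit (μ (act p g))))
  rw [h0] at hm
  refine hγ.unique ((hm.congr ?_).of_eq ?_)
  · filter_upwards [ht] with t e
    rw [S.inv_mul_cancel_left e.symm]
  · rw [hpgμ, S.mul_unit]

end IsRightPrincipal

/-! ### The division map of a principal bundle. -/

section Division

variable {X P M : SmoothManifold.{u}} {S : LieGroupoid X} {μ : SmoothMap P X} {proj : SmoothMap P M}

/-- The arrow `g g'⁻¹` fixes `p`, hence is a unit by freeness. -/
theorem IsRightPrincipal.act_left_cancel {act : P → S.Arr → P} (h : IsRightPrincipal S μ proj act)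
    {p : P} {g g' : S.Arr} (e1 : μ p = S.tgt g) (e2 : μ p = S.tgt g') (e : act p g = act p g') :
    g = g' := by
  have e3 : S.src g' = S.tgt (S.inv g') := (S.tgt_inv g').symm
  have e4 : S.src g = S.tgt (S.inv g') := by rw [← h.μ_act _ _ e1, e, h.μ_act _ _ e2, e3]
  have e5 : act p (S.mul g (S.inv g')) = p := by
    rw [h.act_mul _ _ _ e1 e4, e, ← h.act_mul _ _ _ e2 e3, S.mul_inv, ← e2, h.act_unit]
  have e6 := h.free p _ (by rw [S.tgt_mul _ _ e4, e1]) e5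
  have e7 := S.eq_inv_of_mul_eq_unit e4 (by rw [e6, e1])
  rw [← S.inv_inv g', e7, S.inv_inv]

/-- The division map of a right principal bundle: `p · δ(p, p') = p'` for `p, p'` in the same fibre;
it is smooth. -/
theorem IsRightPrincipal.exists_division {act : P → S.Arr → P}
    (h : IsRightPrincipal S μ proj act) :
    ∃ δ : P → P → S.Arr, SmoothOn₂ δ {z | proj z.1 = proj z.2} ∧
      ∀ p p', proj p = proj p' → μ p = S.tgt (δ p p') ∧ act p (δ p p') = p' := by
  classical
  let δ : P → P → S.Arr := fun p p' =>
    if e : proj p = proj p' then (h.transitive p p' e).choose else S.unit (μ p)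
  have hδ : ∀ p p', proj p = proj p' → μ p = S.tgt (δ p p') ∧ act p (δ p p') = p' :=
    fun p p' e => by
      simp only [δ, dif_pos e]
      exact (h.transitive p p' e).choose_spec
  refine ⟨δ, ?_, hδ⟩
  -- A proper map is closed, and freeness makes this one injective. Continuity of its inverse on the
  -- image is continuity of `δ`; no separation of the space of arrows is used.
  have hemb : IsClosedEmbedding
      (fun z : {z : P × S.Arr // μ z.1 = S.tgt z.2} => (z.1.1, act z.1.1 z.1.2)) := by
    refine .of_continuous_injective_isClosedMap h.proper.continuous ?_ h.proper.isClosedMap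
    rintro ⟨⟨p, g⟩, e1⟩ ⟨⟨p', g'⟩, e2⟩ e
    simp only [Prod.mk.injEq] at e
    obtain ⟨rfl, e⟩ := e
    exact Subtype.ext (Prod.ext rfl (h.act_left_cancel e1 e2 e))
  have hcont : ContinuousOn (fun z : P × P => δ z.1 z.2) {z | proj z.1 = proj z.2} := by
    rw [continuousOn_iff_continuous_domRestrict]
    let k : {z : P × P | proj z.1 = proj z.2} → {z : P × S.Arr // μ z.1 = S.tgt z.2} :=
      fun z => ⟨(z.1.1, δ z.1.1 z.1.2), (hδ _ _ z.2).1⟩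
    have hk : Continuous k := by
      rw [hemb.isInducing.continuous_iff]
      refine continuous_subtype_val.congr fun z => ?_
      exact Prod.ext rfl (hδ _ _ z.2).2.symm
    exact continuous_snd.comp (continuous_subtype_val.comp hk)
  rintro ⟨p, p'⟩ hp
  obtain ⟨hpg, hact⟩ := hδ p p' hp
  set g := δ p p' with hg
  obtain ⟨ρ, hρ⟩ := h.submersion_μ.exists_isFibreProjectionAt p
  have hρs := hρ.smooth
  have hρm := hρ.map_apply
  have hρp : ρ (p, S.tgt g) = p := by rw [← hpg]; exact hρ.apply_self.self_of_nhds
  rw [hpg] at hρs hρm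
  -- The map `(p, g) ↦ (a (p, g), g)` is a smooth local retraction onto the composable pairs, the
  -- fixed set to which `exists_contMDiffAt_leftInverse` is applied.
  let a : P × S.Arr → P := fun z => ρ (z.1, S.tgt z.2)
  have ha : ContMDiffAt ((𝓡 P.dim).prod (𝓡 S.Arr.dim)) (𝓡 P.dim) ∞ a (p, g) :=
    ContMDiffAt.comp (p, g) (g := ρ) hρs
      (contMDiffAt_fst.prodMk (S.tgt.contMDiff.contMDiffAt.comp (p, g) contMDiffAt_snd))
  have hpair : Tendsto (fun z : P × S.Arr => (z.1, S.tgt z.2)) (𝓝 (p, g)) (𝓝 (p, S.tgt g)) := by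
    rw [nhds_prod_eq, nhds_prod_eq]
    exact tendsto_fst.prodMk
      ((S.tgt.contMDiff.continuous.continuousAt (x := g)).tendsto.comp tendsto_snd)
  have haZ : ∀ᶠ z in 𝓝 (p, g), μ (a z) = S.tgt z.2 := hpair.eventually hρm
  have haf : ContMDiffAt ((𝓡 P.dim).prod (𝓡 S.Arr.dim)) (𝓡 P.dim) ∞
      (fun z => act (a z) z.2) (p, g) := h.smooth_act.contMDiffAt_comp ha contMDiffAt_snd haZ
  have hap : a (p, g) = p := hρp
  obtain ⟨k, hk, hkz⟩ := exists_contMDiffAt_leftInverse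
    (I := (𝓡 P.dim).prod (𝓡 S.Arr.dim)) (I' := (𝓡 P.dim).prod (𝓡 P.dim))
    (r := fun z => (a z, z.2)) (f := fun z => (a z, act (a z) z.2)) (z₀ := (p, g))
    (ha.prodMk contMDiffAt_snd) (ha.prodMk haf) (by rw [hap]) (by
      -- Immersion property: if the `P`-component and the product both have zero velocity, the arrow
      -- component is tangent to a target fibre and acts by zero, so it vanishes by infinitesimal
      -- freeness.
      intro γ v hγ hfγ
      have h1 : HasVelocity (𝓡 P.dim) (fun t => a (γ t)) p 0 := hfγ.fst.of_eq hap
      have h2 := hγ.snd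
      have hZ : ∀ᶠ t in 𝓝 0, μ (a (γ t)) = S.tgt (γ t).2 := hγ.tendsto.eventually haZ
      have h3 := h.smooth_act.hasVelocity (p := p) (q := g) hpg h1 h2 hZ
      have h4 : HasVelocity (𝓡 P.dim) (fun t => act (a (γ t)) (γ t).2) (act p g) 0 :=
        hfγ.snd.of_eq (by simp only [hap])
      have h5 : HasVelocity (𝓡 X.dim) (fun t => μ (a (γ t))) (S.tgt g) 0 := by
        have := (h1.comp (f := μ) μ.contMDiff.contMDiffAt).of_eq hpg
        rwa [map_zero] at this
      have h6 : D S.tgt g (v : _ × _).2 = 0 :=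
        (h2.comp (f := S.tgt) S.tgt.contMDiff.contMDiffAt).unique
          (h5.congr (hZ.mono fun t e => e.symm))
      have h7 := h.eq_zero_of_D₂_act_eq_zero hpg h6 (h3.unique h4)
      rw [h7] at h2
      exact h1.prodMk h2)
  rw [hap, hact] at hk
  have hk2 : ContMDiffAt ((𝓡 P.dim).prod (𝓡 P.dim)) (𝓡 S.Arr.dim) ∞ (fun z => (k z).2) (p, p') :=
    contMDiffAt_snd.comp (p, p') hk
  refine hk2.contMDiffWithinAt.congr_of_eventuallyEq_of_mem ?_ hp
  -- The left inverse `k` is valid only near `(p, g)`. Continuity of `δ` guarantees that `(p, δ p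
  -- p')` stays there.
  have htend : Tendsto (fun z : P × P => (z.1, δ z.1 z.2))
      (𝓝[{z | proj z.1 = proj z.2}] (p, p')) (𝓝 (p, g)) :=
    (continuousAt_fst.mono_left nhdsWithin_le_nhds).prodMk_nhds (hcont (p, p') hp)
  have hfst : Tendsto Prod.fst (𝓝 (p, g)) (𝓝 p) := continuousAt_fst
  have hself : ∀ᶠ z in 𝓝 (p, g), ρ (z.1, μ z.1) = z.1 := hfst.eventually hρ.apply_self
  filter_upwards [htend.eventually hkz, self_mem_nhdsWithin, htend.eventually hself]
    with z h1 h2 h3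
  obtain ⟨h4, h5⟩ := hδ z.1 z.2 h2
  have h6 : a (z.1, δ z.1 z.2) = z.1 := by
    simp only [a]
    rw [← h4]
    exact h3
  have h7 := h1 (by simp only [h6])
  simp only [h6, h5] at h7
  rw [h7]

/-- A left principal bundle is a right principal bundle for the action by inverses. -/
theorem IsLeftPrincipal.isRightPrincipal {act : S.Arr → P → P} (h : IsLeftPrincipal S μ proj act) :
    IsRightPrincipal S μ proj (fun p g => act (S.inv g) p) where
  smooth_act := by
    refine ContMDiffOn.comp (t := {z : S.Arr × P | S.src z.1 = μ z.2})
      (f := fun z : P × S.Arr => (S.inv z.2, z.1)) h.smooth_act ?_ fun z hz => ?_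
    · exact ((S.inv.contMDiff.comp contMDiff_snd).prodMk contMDiff_fst).contMDiffOn
    · exact (S.src_inv _).trans (Eq.symm hz)
  μ_act p g e := by rw [h.μ_act _ _ ((S.src_inv g).trans e.symm), S.tgt_inv]
  act_mul p g k e1 e2 := by
    rw [S.inv_mul_rev e2, h.mul_act _ _ _ (by rw [S.src_inv, S.tgt_inv, e2])
      ((S.src_inv g).trans e1.symm)]
  act_unit p := by rw [S.inv_unit, h.unit_act]
  submersion_μ := h.submersion_μ
  submersion_proj := h.submersion_proj
  proj_act p g e := h.proj_act _ _ ((S.src_inv g).trans e.symm)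
  transitive p p' e := by
    obtain ⟨g, h1, h2⟩ := h.transitive p p' e
    exact ⟨S.inv g, by rw [S.tgt_inv, h1], by rw [S.inv_inv, h2]⟩
  free p g e1 e2 := by
    have := h.free _ _ ((S.src_inv g).trans e1.symm) e2
    rw [← S.inv_inv g, this, S.inv_unit]
  proper := by
    let k : {z : P × S.Arr // μ z.1 = S.tgt z.2} ≃ₜ {z : S.Arr × P // S.src z.1 = μ z.2} :=
      { toFun := fun z => ⟨(S.inv z.1.2, z.1.1), (S.src_inv _).trans z.2.symm⟩
        invFun := fun z => ⟨(z.1.2, S.inv z.1.1), by simpa [S.tgt_inv] using z.2.symm⟩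
        left_inv := fun z => by simp [S.inv_inv]
        right_inv := fun z => by simp [S.inv_inv]
        continuous_toFun := by
          refine Continuous.subtype_mk ?_ _
          exact (S.inv.contMDiff.continuous.comp (continuous_snd.comp continuous_subtype_val)).prodMk
            (continuous_fst.comp continuous_subtype_val)
        continuous_invFun := by
          refine Continuous.subtype_mk ?_ _
          exact (continuous_snd.comp continuous_subtype_val).prodMk
            (S.inv.contMDiff.continuous.comp (continuous_fst.comp continuous_subtype_val)) }
    exact ((Homeomorph.prodComm P P).isProperMap.comp h.proper).comp k.isProperMap
  t2_base := h.t2_base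
  secondCountable_base := h.secondCountable_base

end Division

/-! ### Representations and inverses; the identity isomorphism. -/

namespace PfaffianGroupoid

variable {X : SmoothManifold.{u}} (S : PfaffianGroupoid X)

theorem rep_congr {g g' : S.Arr} (e : g = g') {x y : X} (hx : S.src g = x) (hy : S.tgt g = y)
    (hx' : S.src g' = x) (hy' : S.tgt g' = y) : S.rep g hx hy = S.rep g' hx' hy' := by
  subst e
  rfl

theorem rep_inv_rep (g : S.Arr) {x y : X} (hx : S.src g = x) (hy : S.tgt g = y)
    (hx' : S.src (S.inv g) = y) (hy' : S.tgt (S.inv g) = x) (e : S.E.Fib x) :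
    S.rep (S.inv g) hx' hy' (S.rep g hx hy e) = e := by
  subst hx hx'
  have h1 := S.rep_mul (S.inv g) g (S.src_inv g) rfl hy' e
  rw [S.rep_congr (S.inv_mul g) _ _ (S.src_unit _) (S.tgt_unit _), S.rep_unit] at h1
  exact h1.symm

theorem rep_rep_inv (g : S.Arr) {x y : X} (hx : S.src g = x) (hy : S.tgt g = y)
    (hx' : S.src (S.inv g) = y) (hy' : S.tgt (S.inv g) = x) (e : S.E.Fib y) :
    S.rep g hx hy (S.rep (S.inv g) hx' hy' e) = e := by
  have h1 := S.rep_inv_rep (S.inv g) hx' hy' (by rw [S.inv_inv, hx]) (by rw [S.inv_inv, hy]) e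
  rwa [S.rep_congr (S.inv_inv g) _ _ hx hy] at h1

/-- The identity isomorphism of a Pfaffian groupoid. -/
noncomputable def isoRefl : PfaffianIso S S where
  φ := Diffeomorph.refl (𝓡 X.dim) X ∞
  Φ := Diffeomorph.refl (𝓡 S.Arr.dim) S.Arr ∞
  src_Φ _ := rfl
  tgt_Φ _ := rfl
  Φ_mul _ _ _ := rfl
  Ψ x y h := by
    have h' : x = y := h
    subst h'
    exact LinearEquiv.refl ℝ _
  smooth_Ψ := contMDiff_id
  smooth_Ψ_symm := contMDiff_id
  Ψ_rep _ _ := rfl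
  pullback_form g v := by
    have : D (Diffeomorph.refl (𝓡 S.Arr.dim) S.Arr ∞) g = ContinuousLinearMap.id ℝ (Tan S.Arr g) :=
      mfderiv_id
    rw [this]
    rfl

end PfaffianGroupoid

/-! ### From a bibundle to a gauge groupoid. -/

namespace PrincipalPfaffianBibundle

variable {X₁ X₂ : SmoothManifold.{u}} {S₁ : PfaffianGroupoid X₁} {S₂ : PfaffianGroupoid X₂}
  (R : PrincipalPfaffianBibundle S₁ S₂)

/-- The points `p` and `p · g` have the same `μ₁`-moment only up to a proof; naming the fibre by a
free index `x` lets the same `α` be used at both. -/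
theorem Φ_right' {p : R.P} {g : S₂.Arr} (h : R.μ₂ p = S₂.tgt g) {x : X₁} (hx : R.μ₁ p = x)
    (hx' : R.μ₁ (R.act₂ p g) = x) (hy : R.μ₂ (R.act₂ p g) = S₂.src g) (α : S₁.E.Fib x) :
    R.Φ (R.act₂ p g) hx' hy α =
      S₂.rep (S₂.inv g) (S₂.src_inv g) (S₂.tgt_inv g) (R.Φ p hx h α) := by
  subst hx
  exact R.Φ_right p g h α

/-- Multiplicativity reads `Φ (θ w) = g⁻¹ (Φ (θ v) + ω a)` at `p · g`. Since `Φ` at `p · g` is `g⁻¹`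
composed with `Φ` at `p`, applying `g` and subtracting isolates `ω a` in the shape of the gauge
form. -/
theorem form_eq {p p' : R.P} {g : S₂.Arr} (hpg : R.μ₂ p = S₂.tgt g) (e : R.act₂ p g = p')
    (h : R.μ₁ p = R.μ₁ p') {v : Tan R.P p} {w : Tan R.P p'} {a : Tan S₂.Arr g}
    (ha : D R.μ₂ p v = D S₂.tgt g a) (hw : D₂ R.act₂ {z | R.μ₂ z.1 = S₂.tgt z.2} p g v a = w) :
    S₂.form g hpg.symm a = R.Φ p h rfl (R.θ p' rfl w - R.θ p h v) := by
  subst e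
  subst hw
  have h1 := R.right.multiplicative p g hpg v a ha
  simp only [LinearMap.comp_apply, LinearEquiv.coe_coe] at h1
  rw [R.Φ_right' hpg h, ← map_add] at h1
  have h2 := congrArg (S₂.rep g rfl rfl) h1
  rw [S₂.rep_rep_inv, S₂.rep_rep_inv] at h2
  have h3 : ∀ {y : X₂} (hy : R.μ₂ p = y) {x : X₁} (hx : R.μ₁ p = x),
      R.Φ p rfl hy (R.θ p rfl v) = R.Φ p hx hy (R.θ p hx v) := by
    intro y hy x hx
    subst hx
    rfl
  rw [h3 hpg h] at h2
  have h4 : ∀ {y : X₂} (hy : R.μ₂ p = y) (hy' : S₂.tgt g = y),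
      S₂.form g hy' a = R.Φ p h hy (R.θ _ rfl (D₂ R.act₂ {z | R.μ₂ z.1 = S₂.tgt z.2} p g v a)
        - R.θ p h v) := by
    intro y hy hy'
    subst hy'
    rw [map_sub, h2]
    abel
  exact h4 rfl hpg.symm

/-- The left principal bundle underlying a bibundle. -/
def toBundle : PrincipalPfaffianBundle S₁ X₂ where
  P := R.P
  μ := R.μ₁
  proj := R.μ₂
  act := R.act₁
  θ := R.θ
  isPfaffian := R.left

/-- The structure groupoid on the right of a bibundle is its gauge groupoid. -/
theorem nonempty_gauge : Nonempty (PfaffianGauge R.toBundle S₂) := by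
  have hR := R.right.principal
  have hL := R.left.principal
  -- The quotient map of the gauge groupoid is the division map of the right action.
  obtain ⟨q, hq, hqs⟩ := hR.exists_division
  have hq' : ∀ {p : R.P} {g : S₂.Arr}, R.μ₂ p = S₂.tgt g → q p (R.act₂ p g) = g := fun {p g} e =>
    hR.act_left_cancel (hqs _ _ (hR.proj_act p g e).symm).1 e (hqs _ _ (hR.proj_act p g e).symm).2
  have src_q : ∀ p p', R.μ₁ p = R.μ₁ p' → S₂.src (q p p') = R.μ₂ p' := fun p p' e => by
    rw [← hR.μ_act _ _ (hqs p p' e).1, (hqs p p' e).2]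
  refine ⟨{
    q := q
    smooth_q := hq
    submersion_q := ?_
    surjective_q := ?_
    q_eq_iff := ?_
    src_q := src_q
    tgt_q := fun p p' e => (hqs p p' e).1.symm
    mul_q := ?_
    j := R.Φ
    isBundleIso_j := R.isBundleIso
    j_act := R.Φ_left
    rep_q := ?_
    form_q := ?_ }⟩
  · intro p p' e a
    obtain ⟨hpg, hact⟩ := hqs p p' e
    -- To hit a tangent vector `a`, take curves `γ` in `P` and `β` in the arrows with `β` of
    -- velocity `a` and composable with `γ`; then `q γ (γ · β) = β`.
    obtain ⟨v, hv⟩ := hR.submersion_μ.surjective_D p (D S₂.tgt (q p p') a)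
    obtain ⟨γ, β, hγ, hβ, hs⟩ := hR.submersion_μ.exists_hasVelocity S₂.tgt.contMDiff hpg hv
    obtain ⟨w, h1⟩ : ∃ w : Tan R.P p',
        HasVelocity (𝓡 R.P.dim) (fun t => R.act₂ (γ t) (β t)) p' w :=
      ⟨_, (hR.smooth_act.hasVelocity (p := p) (q := q p p') hpg hγ hβ hs).of_eq hact⟩
    have h2 : ∀ᶠ t in 𝓝 0, R.μ₁ (R.act₂ (γ t) (β t)) = R.μ₁ (γ t) :=
      hs.mono fun t e => hR.proj_act _ _ e
    refine ⟨v, w, ?_, ?_⟩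
    rotate_left
    · refine (hq.hasVelocity (p := p) (q := p') e hγ h1 (h2.mono fun t e => e.symm)).unique ?_
      exact hβ.congr (hs.mono fun t e => hq' e)
    · have h3 := h1.comp (f := R.μ₁) R.μ₁.contMDiff.contMDiffAt
      have h4 := hγ.comp (f := R.μ₁) R.μ₁.contMDiff.contMDiffAt
      exact (h4.of_eq e).unique (h3.congr (h2.mono fun t e => e.symm))
  · intro a
    obtain ⟨p, hp⟩ := hR.submersion_μ.1 (S₂.tgt a)
    exact ⟨p, R.act₂ p a, (hR.proj_act p a hp).symm, hq' hp⟩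
  · intro p p' r r' e e'
    obtain ⟨h1, h2⟩ := hqs p p' e
    obtain ⟨h3, h4⟩ := hqs r r' e'
    constructor
    · intro h
      -- Equal quotients have equal targets, so `p` and `r` lie in one `μ₂`-fibre and some `g`
      -- carries `p` to `r`. Commutation of the actions forces the same `g` to carry `p'` to `r'`.
      obtain ⟨g, hg, hgr⟩ := hL.transitive p r (h1.trans ((congrArg S₂.tgt h).trans h3.symm))
      refine ⟨g, hg, hgr, ?_⟩
      change R.act₁ g p' = r'
      rw [← h2, ← R.commute g p _ hg h1, hgr, h, h4]
    · rintro ⟨g, hg, hgr, hgr'⟩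
      change R.act₁ g p = r at hgr
      change R.act₁ g p' = r' at hgr'
      have h5 : R.μ₂ r = S₂.tgt (q p p') := by rw [← h1, ← hgr, hL.proj_act g p hg]
      refine hR.act_left_cancel h5 h3 ?_
      rw [h4, ← hgr, R.commute g p _ hg h1, h2, hgr']
  · intro p p' p'' e e'
    obtain ⟨h1, h2⟩ := hqs p p' e
    obtain ⟨h3, h4⟩ := hqs p' p'' e'
    obtain ⟨h5, h6⟩ := hqs p p'' (e.trans e')
    have h7 : S₂.src (q p p') = S₂.tgt (q p' p'') := (src_q p p' e).trans h3
    refine hR.act_left_cancel (p := p) ?_ h5 ?_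
    · rw [S₂.tgt_mul _ _ h7, h1]
    · rw [hR.act_mul _ _ _ h1 h7, h2, h4, h6]
  · intro p p' e α
    have key : ∀ {g : S₂.Arr} {p' : R.P} (hpg : R.μ₂ p = S₂.tgt g) (_ : R.act₂ p g = p')
        (hs : S₂.src g = R.μ₂ p') (h : R.μ₁ p = R.μ₁ p') (α : S₁.E.Fib (R.μ₁ p')),
        S₂.rep g hs hpg.symm (R.Φ p' rfl rfl α) = R.Φ p h rfl α := by
      intro g p' hpg hact hs h α
      subst hact
      have h1 : ∀ {x y} (hx : R.μ₂ (R.act₂ p g) = x) (hx' : S₂.src g = x) (hy : R.μ₂ p = y)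
          (hy' : S₂.tgt g = y), S₂.rep g hx' hy' (R.Φ _ rfl hx α) = R.Φ p h hy α := by
        intro x y hx hx' hy hy'
        subst hx' hy'
        rw [R.Φ_right' hy h, S₂.rep_rep_inv]
      exact h1 rfl hs rfl hpg.symm
    exact key (hqs p p' e).1 (hqs p p' e).2 _ e α
  · intro p p' e v w hvw
    obtain ⟨hpg, hact⟩ := hqs p p' e
    obtain ⟨γ, γ', hγ, hγ', hs⟩ := hL.submersion_μ.exists_hasVelocity R.μ₁.contMDiff e hvw
    have h1 := hq.hasVelocity (p := p) (q := p') e hγ hγ' hs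
    have h2 : ∀ᶠ t in 𝓝 0, R.μ₂ (γ t) = S₂.tgt (q (γ t) (γ' t)) := hs.mono fun t e => (hqs _ _ e).1
    refine R.form_eq hpg hact e ?_ ?_
    · have h3 := hγ.comp (f := R.μ₂) R.μ₂.contMDiff.contMDiffAt
      have h4 := h1.comp (f := S₂.tgt) S₂.tgt.contMDiff.contMDiffAt
      exact (h3.of_eq hpg).unique (h4.congr h2)
    · have h3 := hR.smooth_act.hasVelocity (p := p) (q := q p p') hpg hγ h1 h2
      exact (h3.of_eq hact).unique (hγ'.congr (hs.mono fun t e => (hqs _ _ e).2))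

end PrincipalPfaffianBibundle

/-! ### Smoothness of maps to and from pulled back vector bundles. -/

section Pullback

variable {P X Y : SmoothManifold.{u}}

/-- A map into a pulled back vector bundle is smooth if its two components are. -/
theorem contMDiff_pullback {E H A : Type*} [NormedAddCommGroup E] [NormedSpace ℝ E]
    [TopologicalSpace H] {I : ModelWithCorners ℝ E H} [TopologicalSpace A] [ChartedSpace H A]
    {μ : SmoothMap P X} {F : VecBundle X} {f : A → TotalSpace F.Model ((μ : P → X) *ᵖ F.Fib)}
    (h₁ : ContMDiff I (𝓡 P.dim) ∞ (fun a => (f a).1))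
    (h₂ : ContMDiff I ((𝓡 X.dim).prod 𝓘(ℝ, F.Model)) ∞
      (fun a => (⟨μ (f a).1, (f a).2⟩ : F.Tot))) :
    ContMDiff I ((𝓡 P.dim).prod 𝓘(ℝ, F.Model)) ∞ f := fun a =>
  contMDiffAt_totalSpace.2 ⟨h₁ a, (contMDiffAt_totalSpace.1 (h₂ a)).2⟩

/-- The canonical map from a pulled back vector bundle is smooth. -/
theorem contMDiff_pullback_lift (μ : SmoothMap P X) (F : VecBundle X) :
    ContMDiff ((𝓡 P.dim).prod 𝓘(ℝ, F.Model)) ((𝓡 X.dim).prod 𝓘(ℝ, F.Model)) ∞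
      (fun z : TotalSpace F.Model ((μ : P → X) *ᵖ F.Fib) => (⟨μ z.1, z.2⟩ : F.Tot)) := fun z =>
  contMDiffAt_totalSpace.2 ⟨(μ.contMDiff.comp (contMDiff_proj _)) z,
    (contMDiffAt_totalSpace.1 (contMDiffAt_id (x := z))).2⟩

/-- Composing a smooth form with a smooth bundle map gives a smooth form. -/
theorem SmoothForm.comp {μ : SmoothMap P X} {ν : SmoothMap P Y} {E : VecBundle X} {F : VecBundle Y}
    {θ : PreForm μ E} (hθ : SmoothForm μ E θ) {f : FibreEquivs μ ν E F}
    (hf : SmoothFibreMaps μ ν E F (fun p => f p rfl rfl)) :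
    SmoothForm ν F (fun p _ hy => (f p rfl hy).toLinearMap ∘ₗ θ p rfl) :=
  ContMDiff.comp hf (contMDiff_pullback
    (f := fun v : TangentBundle (𝓡 P.dim) P => ⟨v.1, θ v.1 rfl v.2⟩)
    (contMDiff_proj _) hθ)

end Pullback

/-! ### From a gauge groupoid to a bibundle. -/

namespace PfaffianGauge

variable {X M : SmoothManifold.{u}} {S : PfaffianGroupoid X} {B : PrincipalPfaffianBundle S M}
  {G : PfaffianGroupoid M} (h : PfaffianGauge B G)

/-- The arrow relating the two pairs fixes `p`, so it is a unit. -/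
theorem q_left_cancel {p p' p'' : B.P} (e : B.μ p = B.μ p') (e' : B.μ p = B.μ p'')
    (hq : h.q p p' = h.q p p'') : p' = p'' := by
  obtain ⟨g, h1, h2, h3⟩ := (h.q_eq_iff p p' p p'' e e').1 hq
  have h4 := B.isPfaffian.principal.free g p h1 h2
  rw [← h3, h4, e, B.isPfaffian.principal.unit_act]

theorem q_self (p : B.P) : h.q p p = G.unit (B.proj p) := by
  have h2 : G.src (h.q p p) = G.tgt (h.q p p) := by rw [h.src_q p p rfl, h.tgt_q p p rfl]
  rw [G.eq_unit_of_mul_self h2 (h.mul_q p p p rfl rfl), h.tgt_q p p rfl]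

/-- Transitivity on the fibres of `proj` moves any representative of `a` to one whose first entry is
`p`. -/
theorem exists_q_eq {p : B.P} {a : G.Arr} (e : B.proj p = G.tgt a) :
    ∃ p', B.μ p = B.μ p' ∧ h.q p p' = a := by
  obtain ⟨r, r', hr, ha⟩ := h.surjective_q a
  have h1 : B.proj r = B.proj p := by rw [e, ← ha, h.tgt_q r r' hr]
  obtain ⟨g, hg, hgr⟩ := B.isPfaffian.principal.transitive r p h1
  have h2 : B.μ p = B.μ (B.act g r') := by
    rw [← hgr, B.isPfaffian.principal.μ_act g r hg,
      B.isPfaffian.principal.μ_act g r' (hg.trans hr)]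
  exact ⟨_, h2, by rw [← ha]; exact ((h.q_eq_iff r r' p _ hr h2).2 ⟨g, hg, hgr, rfl⟩).symm⟩

open scoped Classical in
/-- The right action of the gauge groupoid: `p · [p, p'] = p'`. -/
noncomputable def act (p : B.P) (a : G.Arr) : B.P :=
  if e : B.proj p = G.tgt a then (h.exists_q_eq e).choose else p

theorem μ_act {p : B.P} {a : G.Arr} (e : B.proj p = G.tgt a) : B.μ p = B.μ (h.act p a) := by
  rw [act, dif_pos e]
  exact (h.exists_q_eq e).choose_spec.1

theorem q_act {p : B.P} {a : G.Arr} (e : B.proj p = G.tgt a) : h.q p (h.act p a) = a := by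
  rw [act, dif_pos e]
  exact (h.exists_q_eq e).choose_spec.2

/-- Determines the action by its defining property, so that neither the choice nor the default value
`p` in its definition matters. -/
theorem act_eq {p p' : B.P} {a : G.Arr} (e : B.μ p = B.μ p') (hq : h.q p p' = a) :
    h.act p a = p' := by
  have h1 : B.proj p = G.tgt a := by rw [← hq, h.tgt_q p p' e]
  exact h.q_left_cancel (h.μ_act h1) e ((h.q_act h1).trans hq.symm)

/-- The projection to the gauge groupoid has smooth local sections. -/
theorem exists_section {p p' : B.P} (e : B.μ p = B.μ p') :
    ∃ k k' : G.Arr → B.P, ContMDiffAt (𝓡 G.Arr.dim) (𝓡 B.P.dim) ∞ k (h.q p p') ∧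
      ContMDiffAt (𝓡 G.Arr.dim) (𝓡 B.P.dim) ∞ k' (h.q p p') ∧
      ∀ᶠ a in 𝓝 (h.q p p'), B.μ (k a) = B.μ (k' a) ∧ h.q (k a) (k' a) = a := by
  have hμ := B.isPfaffian.principal.submersion_μ
  obtain ⟨ρ, hρ⟩ := hμ.exists_isFibreProjectionAt p
  have hρs := hρ.smooth
  have hρm := hρ.map_apply
  have hρp : ρ (p, B.μ p') = p := by rw [← e]; exact hρ.apply_self.self_of_nhds
  rw [e] at hρs hρm
  -- Adjusting the first entry puts nearby pairs into the fibre square, so that `q` becomes a smooth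
  -- map on a neighbourhood in the full product and the section theorem applies to it.
  let b : B.P × B.P → B.P := fun z => ρ (z.1, B.μ z.2)
  have hb : ContMDiffAt ((𝓡 B.P.dim).prod (𝓡 B.P.dim)) (𝓡 B.P.dim) ∞ b (p, p') :=
    ContMDiffAt.comp (p, p') (g := ρ) hρs
      (contMDiffAt_fst.prodMk (B.μ.contMDiff.contMDiffAt.comp (p, p') contMDiffAt_snd))
  have hpair : Tendsto (fun z : B.P × B.P => (z.1, B.μ z.2)) (𝓝 (p, p')) (𝓝 (p, B.μ p')) := by
    rw [nhds_prod_eq, nhds_prod_eq]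
    exact tendsto_fst.prodMk
      ((B.μ.contMDiff.continuous.continuousAt (x := p')).tendsto.comp tendsto_snd)
  have hbZ : ∀ᶠ z in 𝓝 (p, p'), B.μ (b z) = B.μ z.2 := hpair.eventually hρm
  have hbp : b (p, p') = p := hρp
  have hf : ContMDiffAt ((𝓡 B.P.dim).prod (𝓡 B.P.dim)) (𝓡 G.Arr.dim) ∞
      (fun z => h.q (b z) z.2) (p, p') := h.smooth_q.contMDiffAt_comp hb contMDiffAt_snd hbZ
  have hq₀ : h.q (b (p, p')) p' = h.q p p' := by rw [hbp]
  obtain ⟨k, hk, hk₀, hky⟩ := exists_contMDiffAt_section hf (by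
    intro u
    obtain ⟨v, w, hvw, hu⟩ := h.submersion_q p p' e (u : EuclideanSpace ℝ (Fin G.Arr.dim))
    obtain ⟨γ, γ', hγ, hγ', hs⟩ := hμ.exists_hasVelocity B.μ.contMDiff e hvw
    have h1 := h.smooth_q.hasVelocity (p := p) (q := p') e hγ hγ' hs
    rw [hu] at h1
    refine ⟨_, _, hγ.prodMk hγ', (h1.congr ?_).of_eq hq₀.symm⟩
    filter_upwards [hs, hγ.tendsto.eventually hρ.apply_self] with t h2 h3
    simp only [b, Function.comp_apply]
    rw [← h2, h3])
  rw [hq₀] at hk hk₀ hky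
  have hkc : Tendsto k (𝓝 (h.q p p')) (𝓝 (p, p')) := by
    have := hk.continuousAt.tendsto
    rwa [hk₀] at this
  refine ⟨fun a => b (k a), fun a => (k a).2,
    ContMDiffAt.comp _ (g := b) (by rwa [hk₀]) hk, contMDiffAt_snd.comp _ hk, ?_⟩
  filter_upwards [hkc.eventually hbZ, hky] with a h1 h2 using ⟨h1, h2⟩

/-- Locally `a = [k a, k' a]` with `k`, `k'` smooth. If `p = g · k a` then `p · a = g · k' a`, and
`g` depends smoothly on `(p, a)` because it is the inverse of a value of the division map of the
left action. -/
theorem smooth_act : SmoothOn₂ h.act {z | B.proj z.1 = G.tgt z.2} := by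
  rintro ⟨p, a⟩ (hpa : B.proj p = G.tgt a)
  have hL := B.isPfaffian.principal
  obtain ⟨δ, hδ, hδs⟩ := hL.isRightPrincipal.exists_division
  obtain ⟨k, k', hk, hk', hkk⟩ := h.exists_section (h.μ_act hpa)
  rw [h.q_act hpa] at hk hk' hkk
  set Z : Set (B.P × G.Arr) := {z | B.proj z.1 = G.tgt z.2} with hZ
  have hsnd : Tendsto Prod.snd (𝓝[Z] (p, a)) (𝓝 a) :=
    (continuousAt_snd (p := (p, a))).tendsto.mono_left nhdsWithin_le_nhds
  have hev : ∀ᶠ z in 𝓝[Z] (p, a), B.μ (k z.2) = B.μ (k' z.2) ∧ h.q (k z.2) (k' z.2) = z.2 ∧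
      B.proj (k z.2) = B.proj z.1 := by
    filter_upwards [hsnd.eventually hkk, self_mem_nhdsWithin] with z h1 h2
    refine ⟨h1.1, h1.2, ?_⟩
    have h3 := h.tgt_q _ _ h1.1
    rw [h1.2] at h3
    exact h3.symm.trans (Eq.symm h2)
  have hks : ContMDiffWithinAt ((𝓡 B.P.dim).prod (𝓡 G.Arr.dim)) (𝓡 B.P.dim) ∞
      (fun z => k z.2) Z (p, a) :=
    (ContMDiffAt.comp (p, a) (g := k) hk contMDiffAt_snd).contMDiffWithinAt
  have hks' : ContMDiffWithinAt ((𝓡 B.P.dim).prod (𝓡 G.Arr.dim)) (𝓡 B.P.dim) ∞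
      (fun z => k' z.2) Z (p, a) :=
    (ContMDiffAt.comp (p, a) (g := k') hk' contMDiffAt_snd).contMDiffWithinAt
  have hds : ContMDiffWithinAt ((𝓡 B.P.dim).prod (𝓡 G.Arr.dim)) (𝓡 S.Arr.dim) ∞
      (fun z => δ (k z.2) z.1) Z (p, a) :=
    hδ.contMDiffWithinAt_comp hks contMDiffWithinAt_fst hpa (hev.mono fun z hz => hz.2.2)
  have hfin := hL.isRightPrincipal.smooth_act.contMDiffWithinAt_comp hks' hds hpa
    (hev.mono fun z hz => hz.1.symm.trans (hδs _ _ hz.2.2).1)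
  refine hfin.congr_of_eventuallyEq_of_mem ?_ hpa
  filter_upwards [hev] with z hz
  obtain ⟨h1, h2⟩ := hδs _ _ hz.2.2
  have h3 : S.src (S.inv (δ (k z.2) z.1)) = B.μ (k z.2) := (S.src_inv _).trans h1.symm
  have h4 : B.μ z.1 = B.μ (B.act (S.inv (δ (k z.2) z.1)) (k' z.2)) := by
    rw [hL.μ_act _ _ (h3.trans hz.1), ← hL.μ_act _ _ h3, h2]
  exact h.act_eq h4 (((h.q_eq_iff _ _ _ _ hz.1 h4).2 ⟨_, h3, h2, rfl⟩).symm.trans hz.2.1)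

theorem isRightPrincipal : IsRightPrincipal G.toLieGroupoid B.proj B.μ h.act where
  smooth_act := h.smooth_act
  μ_act p a e := by
    have h1 := h.src_q _ _ (h.μ_act e)
    rw [h.q_act e] at h1
    exact h1.symm
  act_mul p a b e e' := by
    have h1 := h.src_q _ _ (h.μ_act e)
    rw [h.q_act e] at h1
    have h2 : B.proj (h.act p a) = G.tgt b := h1.symm.trans e'
    refine h.act_eq ((h.μ_act e).trans (h.μ_act h2)) ?_
    rw [← h.mul_q _ _ _ (h.μ_act e) (h.μ_act h2), h.q_act e, h.q_act h2]
  act_unit p := h.act_eq rfl (h.q_self p)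
  submersion_μ := B.isPfaffian.principal.submersion_proj
  submersion_proj := B.isPfaffian.principal.submersion_μ
  proj_act p a e := (h.μ_act e).symm
  transitive p p' e := ⟨h.q p p', (h.tgt_q p p' e).symm, h.act_eq e rfl⟩
  free p a e e' := by
    have h1 := h.q_act e
    rw [e', h.q_self] at h1
    exact h1.symm
  proper := by
    -- `(p, a) ↦ (p, p · a)` is a homeomorphism onto the fibre square, with inverse given by `q`;
    -- the fibre square is closed because `X` is Hausdorff.
    have := S.t2_base
    have hclosed : IsClosed B.FibreSquare :=
      isClosed_eq (B.μ.contMDiff.continuous.comp continuous_fst)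
        (B.μ.contMDiff.continuous.comp continuous_snd)
    let k : {z : B.P × G.Arr // B.proj z.1 = G.tgt z.2} ≃ₜ B.FibreSquare :=
      { toFun := fun z => ⟨(z.1.1, h.act z.1.1 z.1.2), h.μ_act z.2⟩
        invFun := fun z => ⟨(z.1.1, h.q z.1.1 z.1.2), (h.tgt_q _ _ z.2).symm⟩
        left_inv := fun z => Subtype.ext (Prod.ext rfl (h.q_act z.2))
        right_inv := fun z => Subtype.ext (Prod.ext rfl (h.act_eq z.2 rfl))
        continuous_toFun := by
          refine Continuous.subtype_mk ((continuous_fst.comp continuous_subtype_val).prodMk ?_) _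
          exact continuousOn_iff_continuous_domRestrict.1 h.smooth_act.continuousOn
        continuous_invFun := by
          refine Continuous.subtype_mk ((continuous_fst.comp continuous_subtype_val).prodMk ?_) _
          exact continuousOn_iff_continuous_domRestrict.1 h.smooth_q.continuousOn }
    exact hclosed.isClosedEmbedding_subtypeVal.isProperMap.comp k.isProperMap
  t2_base := S.t2_base
  secondCountable_base := S.secondCountable_base

/-- All base points and the arrow are free indices, so the identity can be used for `p' = p · a`,
where they agree only up to a proof. -/
theorem j_rep {p p' : B.P} (e : B.μ p = B.μ p') {a : G.Arr} (ha : h.q p p' = a)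
    {x : X} (hx : B.μ p' = x) (hx' : B.μ p = x) {y y' : M} (hs : G.src a = y') (ht : G.tgt a = y)
    (hy' : B.proj p' = y') (hy : B.proj p = y) (α : S.E.Fib x) :
    G.rep a hs ht (h.j p' hx hy' α) = h.j p hx' hy α := by
  subst hx ha hy' hy
  exact h.rep_q p p' e α

theorem form_eq {p p' : B.P} (e : B.μ p = B.μ p') {a : G.Arr} (ha : h.q p p' = a) {y : M}
    (ht : G.tgt a = y) (hy : B.proj p = y) {v : Tan B.P p} {w : Tan B.P p'} {b : Tan G.Arr a}
    (hvw : D B.μ p v = D B.μ p' w) (hb : D₂ h.q B.FibreSquare p p' v w = b) :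
    G.form a ht b = h.j p e hy (B.θ p' rfl w) - h.j p rfl hy (B.θ p rfl v) := by
  subst ha hb hy
  have h1 : ∀ {x : X} (hx : B.μ p = x),
      h.j p rfl rfl (B.θ p rfl v) = h.j p hx rfl (B.θ p hx v) := by
    intro x hx
    subst hx
    rfl
  rw [h1 e, ← map_sub]
  exact h.form_q p p' e v w hvw

/-- With `p' = p · a`, the gauge formula gives `ω a + j_p (θ v) = j_p (θ w')`, where `w'` is the
image under the action differential. Since `j_p = a · j_{p · a}`, applying `a⁻¹` yields
multiplicativity. The kernel condition is symmetric in the two projections and unaffected by the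
isomorphism `j`. -/
theorem isRightPfaffian : IsRightPfaffian G B.proj B.μ h.act
    (fun p _ hy => (h.j p rfl hy).toLinearMap ∘ₗ B.θ p rfl) where
  principal := h.isRightPrincipal
  smooth_θ := B.isPfaffian.smooth_θ.comp h.isBundleIso_j.1
  multiplicative p a e v w hvw := by
    obtain ⟨γ, β, hγ, hβ, hs⟩ := B.isPfaffian.principal.submersion_proj.exists_hasVelocity
      G.tgt.contMDiff e hvw
    have h1 := h.smooth_act.hasVelocity (p := p) (q := a) e hγ hβ hs
    have h2 : ∀ᶠ t in 𝓝 0, B.μ (γ t) = B.μ (h.act (γ t) (β t)) := hs.mono fun t e => h.μ_act e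
    have h3 := h.smooth_q.hasVelocity (p := p) (q := h.act p a) (h.μ_act e) hγ h1 h2
    have h4 := (hγ.comp (f := B.μ) B.μ.contMDiff.contMDiffAt).of_eq (h.μ_act e)
    have h5 := (h1.comp (f := B.μ) B.μ.contMDiff.contMDiffAt).congr h2
    have h6 := (h3.of_eq (h.q_act e)).unique (hβ.congr (hs.mono fun t e => h.q_act e))
    have hsrc : B.proj (h.act p a) = G.src a := h.isRightPrincipal.μ_act p a e
    have h7 := h.form_eq (h.μ_act e) (h.q_act e) rfl e (h4.unique h5) h6
    have h8 := h.j_rep (h.μ_act e) (h.q_act e) rfl (h.μ_act e) rfl rfl hsrc e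
      (B.θ (h.act p a) rfl (D₂ h.act {z | B.proj z.1 = G.tgt z.2} p a v w))
    rw [← map_add, h7]
    simp only [LinearMap.comp_apply, LinearEquiv.coe_coe, add_sub_cancel]
    rw [← h8, G.rep_inv_rep]
  ker_eq p := by
    have h1 : LinearMap.ker ((h.j p rfl rfl).toLinearMap ∘ₗ B.θ p rfl) = LinearMap.ker (B.θ p rfl) :=
      LinearEquiv.ker_comp _ _
    rw [h1]
    exact (B.isPfaffian.ker_eq p).symm

/-- A principal bundle is a bibundle between its structure groupoid and its gauge groupoid. -/
noncomputable def toBibundle : PrincipalPfaffianBibundle S G where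
  P := B.P
  μ₁ := B.μ
  μ₂ := B.proj
  act₁ := B.act
  act₂ := h.act
  θ := B.θ
  Φ := h.j
  isBundleIso := h.isBundleIso_j
  left := B.isPfaffian
  right := h.isRightPfaffian
  commute g p a e e' := by
    have hL := B.isPfaffian.principal
    have h1 : B.μ (B.act g p) = B.μ (B.act g (h.act p a)) := by
      rw [hL.μ_act _ _ e, hL.μ_act _ _ (e.trans (h.μ_act e'))]
    refine h.act_eq h1 ?_
    rw [← (h.q_eq_iff _ _ _ _ (h.μ_act e') h1).2 ⟨g, e, rfl, rfl⟩, h.q_act e']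
  Φ_left := h.j_act
  Φ_right p a e α := by
    have hs : G.src a = B.proj (h.act p a) := (h.isRightPrincipal.μ_act p a e).symm
    have h1 := h.j_rep (h.μ_act e) (h.q_act e) (h.μ_act e).symm rfl rfl rfl hs.symm e α
    rw [← h1, G.rep_inv_rep]

end PfaffianGauge

/-! ### Submersions composed with diffeomorphisms. -/

section Diffeo

variable {M N L : SmoothManifold.{u}}

/-- Smoothness of `e` and `e.symm` makes the transition maps with every chart of the atlas smooth.
-/
theorem mem_maximalAtlas_of_contMDiffOn
    {e : OpenPartialHomeomorph M (EuclideanSpace ℝ (Fin M.dim))}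
    (h : ContMDiffOn (𝓡 M.dim) (𝓡 M.dim) ∞ e e.source)
    (h' : ContMDiffOn (𝓡 M.dim) (𝓡 M.dim) ∞ e.symm e.target) :
    e ∈ IsManifold.maximalAtlas (𝓡 M.dim) ∞ M := by
  have key : ∀ {f f' : OpenPartialHomeomorph M (EuclideanSpace ℝ (Fin M.dim))},
      ContMDiffOn (𝓡 M.dim) (𝓡 M.dim) ∞ f f.source →
      ContMDiffOn (𝓡 M.dim) (𝓡 M.dim) ∞ f'.symm f'.target →
      ContDiffOn ℝ ∞ (f'.symm ≫ₕ f) (f'.symm ≫ₕ f).source := by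
    intro f f' hf hf'
    rw [← contMDiffOn_iff_contDiffOn]
    exact hf.comp' hf'
  intro e' he'
  have he₁ := contMDiffOn_of_mem_maximalAtlas (IsManifold.subset_maximalAtlas (I := 𝓡 M.dim) (n := ∞) he')
  have he₂ := contMDiffOn_symm_of_mem_maximalAtlas (IsManifold.subset_maximalAtlas (I := 𝓡 M.dim) (n := ∞) he')
  constructor
  · refine mem_groupoid_of_pregroupoid.2 ⟨?_, ?_⟩
    · simpa [contDiffPregroupoid] using key he₁ h'
    · simpa [contDiffPregroupoid] using key h he₂
  · refine mem_groupoid_of_pregroupoid.2 ⟨?_, ?_⟩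
    · simpa [contDiffPregroupoid] using key h he₂
    · simpa [contDiffPregroupoid] using key he₁ h'

/-- The composition of a surjective submersion with a diffeomorphism. -/
theorem IsSurjSubmersion.diffeo_comp {f : M → N} (hf : IsSurjSubmersion f) (φ : Diffeo N L) :
    IsSurjSubmersion (φ ∘ f) := by
  refine ⟨φ.surjective.comp hf.1, ?_⟩
  obtain ⟨F, _, _, hF⟩ := hf.2
  refine ⟨F, inferInstance, inferInstance, fun x => ?_⟩
  have hx := hF x
  -- `N.dim` and `L.dim` are not definitionally equal; the differential of `φ` supplies an
  -- identification of the model spaces. The chart `c` of `L` is the adapted chart of `N`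
  -- transported by `φ` and followed by `ε`.
  let ε : EuclideanSpace ℝ (Fin N.dim) ≃L[ℝ] EuclideanSpace ℝ (Fin L.dim) :=
    φ.mfderivToContinuousLinearEquiv (by simp) (f x)
  let c := (φ.symm.toHomeomorph.toOpenPartialHomeomorph ≫ₕ hx.codChart) ≫ₕ
    ε.toHomeomorph.toOpenPartialHomeomorph
  have hc : c ∈ IsManifold.maximalAtlas (𝓡 L.dim) ∞ L := by
    refine mem_maximalAtlas_of_contMDiffOn ?_ ?_
    · have h1 : ContMDiff (𝓡 N.dim) (𝓡 L.dim) ∞ ε := ε.contDiff.contMDiff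
      have h2 := contMDiffOn_of_mem_maximalAtlas hx.codChart_mem_maximalAtlas
      refine (h1.comp_contMDiffOn (h2.comp φ.symm.contMDiff.contMDiffOn ?_))
      intro y hy
      simpa [c] using hy
    · have h1 : ContMDiff (𝓡 L.dim) (𝓡 N.dim) ∞ ε.symm := ε.symm.contDiff.contMDiff
      have h2 := contMDiffOn_symm_of_mem_maximalAtlas hx.codChart_mem_maximalAtlas
      refine (φ.contMDiff.comp_contMDiffOn (h2.comp h1.contMDiffOn ?_))
      intro y hy
      simpa [c] using hy
  refine Manifold.IsSubmersionAtOfComplement.mk_of_charts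
    (hx.equiv.trans (ε.prodCongr (ContinuousLinearEquiv.refl ℝ F))) hx.domChart c
    hx.mem_domChart_source ?_ hx.domChart_mem_maximalAtlas hc ?_ ?_
  · simpa [c] using hx.mem_codChart_source
  · intro y hy
    simpa [c] using hx.source_subset_preimage_source hy
  · intro y hy
    have := hx.writtenInCharts hy
    simp only [Function.comp_apply] at this
    simp [c] at this ⊢
    rw [this]

end Diffeo

/-! ### Consequences of the axioms of an isomorphism. -/

namespace PfaffianIso

variable {X₁ X₂ : SmoothManifold.{u}} {S₁ : PfaffianGroupoid X₁} {S₂ : PfaffianGroupoid X₂}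
  (I : PfaffianIso S₁ S₂)

theorem φ_src_symm (g : S₂.Arr) : I.φ (S₁.src (I.Φ.symm g)) = S₂.src g := by
  rw [← I.src_Φ, I.Φ.apply_symm_apply]

theorem φ_tgt_symm (g : S₂.Arr) : I.φ (S₁.tgt (I.Φ.symm g)) = S₂.tgt g := by
  rw [← I.tgt_Φ, I.Φ.apply_symm_apply]

theorem Φ_unit (x : X₁) : I.Φ (S₁.unit x) = S₂.unit (I.φ x) := by
  have h1 : S₁.src (S₁.unit x) = S₁.tgt (S₁.unit x) := by rw [S₁.src_unit, S₁.tgt_unit]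
  have h2 : S₁.mul (S₁.unit x) (S₁.unit x) = S₁.unit x := by
    have := S₁.mul_unit (S₁.unit x)
    rwa [S₁.src_unit] at this
  have h3 := S₂.eq_unit_of_mul_self (g := I.Φ (S₁.unit x)) (by rw [I.src_Φ, I.tgt_Φ, h1])
    (by rw [← I.Φ_mul _ _ h1, h2])
  rw [h3, I.tgt_Φ, S₁.tgt_unit]

theorem Φ_inv (g : S₁.Arr) : I.Φ (S₁.inv g) = S₂.inv (I.Φ g) := by
  have h1 : S₁.src g = S₁.tgt (S₁.inv g) := (S₁.tgt_inv g).symm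
  refine S₂.eq_inv_of_mul_eq_unit (by rw [I.src_Φ, I.tgt_Φ, h1]) ?_
  rw [← I.Φ_mul _ _ h1, S₁.mul_inv, I.Φ_unit, I.tgt_Φ]

theorem Φ_symm_mul {g k : S₂.Arr} (e : S₂.src g = S₂.tgt k) :
    I.Φ.symm (S₂.mul g k) = S₁.mul (I.Φ.symm g) (I.Φ.symm k) := by
  apply I.Φ.injective
  change I.Φ _ = I.Φ _
  rw [I.Φ_mul, I.Φ.apply_symm_apply, I.Φ.apply_symm_apply, I.Φ.apply_symm_apply]
  apply I.φ.injective
  change I.φ _ = I.φ _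
  rw [I.φ_src_symm, I.φ_tgt_symm, e]

theorem Φ_symm_unit (x : X₁) : I.Φ.symm (S₂.unit (I.φ x)) = S₁.unit x := by
  rw [← I.Φ_unit, I.Φ.symm_apply_apply]

theorem Ψ_rep' {a : S₁.Arr} {b : S₂.Arr} (e : I.Φ a = b) {x y : X₁} {x' y' : X₂}
    (hx : S₁.src a = x) (hy : S₁.tgt a = y) (hx' : S₂.src b = x') (hy' : S₂.tgt b = y')
    (hφ : I.φ x = x') (hφ' : I.φ y = y') (α : S₁.E.Fib x) :
    I.Ψ hφ' (S₁.rep a hx hy α) = S₂.rep b hx' hy' (I.Ψ hφ α) := by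
  subst e hx hy hφ hφ'
  exact I.Ψ_rep a α

theorem pullback_form' {a : S₁.Arr} {b : S₂.Arr} (e : I.Φ a = b) {y : X₁} {y' : X₂}
    (hy : S₁.tgt a = y) (hy' : S₂.tgt b = y') (hφ : I.φ y = y') {v : Tan S₁.Arr a}
    {w : Tan S₂.Arr b} (hw : D I.Φ a v = w) : S₂.form b hy' w = I.Ψ hφ (S₁.form a hy v) := by
  subst e hw hy hφ
  exact I.pullback_form a v

/-- Smoothness of the inverse of `Ψ` is recorded at the base point `I.φ.symm y`. As an equality in
the total space it transfers to any named preimage `x`. -/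
theorem mk_Ψ_symm {x : X₁} {y : X₂} (h : I.φ x = y) (α : S₂.E.Fib y) :
    (⟨I.φ.symm y, (I.Ψ (I.φ.apply_symm_apply y)).symm α⟩ : S₁.E.Tot) = ⟨x, (I.Ψ h).symm α⟩ := by
  have key : ∀ (x' : X₁) (h' : I.φ x' = y), x' = x →
      (⟨x', (I.Ψ h').symm α⟩ : S₁.E.Tot) = ⟨x, (I.Ψ h).symm α⟩ := by
    rintro x' h' rfl
    rfl
  exact key _ _ (by rw [← h, I.φ.symm_apply_apply])

end PfaffianIso

/-! ### Transport of bibundles along isomorphisms, and the theorem. -/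

namespace PrincipalPfaffianBibundle

variable {X₁ X X₂ : SmoothManifold.{u}} {S₁ : PfaffianGroupoid X₁} {G : PfaffianGroupoid X}
  {S₂ : PfaffianGroupoid X₂} (R : PrincipalPfaffianBibundle S₁ G) (I : PfaffianIso G S₂)

/-- The right moment map after transport along an isomorphism. -/
noncomputable def transMoment : SmoothMap R.P X₂ := ⟨I.φ ∘ R.μ₂, I.φ.contMDiff.comp R.μ₂.contMDiff⟩

/-- The bundle isomorphism after transport along an isomorphism. -/
noncomputable def transFibreEquivs : FibreEquivs R.μ₁ (R.transMoment I) S₁.E S₂.E :=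
  fun p _ _ hx hy => (R.Φ p hx rfl).trans (I.Ψ hy)

theorem transFibreEquivs_apply {p : R.P} {x : X₁} {y : X} {z : X₂} (hx : R.μ₁ p = x)
    (hy : R.μ₂ p = y) (hφ : I.φ y = z) (hz : R.transMoment I p = z) (α : S₁.E.Fib x) :
    R.transFibreEquivs I p hx hz α = I.Ψ hφ (R.Φ p hx hy α) := by
  subst hy
  rfl

theorem transMoment_eq_iff {p : R.P} {g : S₂.Arr} :
    R.transMoment I p = S₂.tgt g ↔ R.μ₂ p = G.tgt (I.Φ.symm g) := by
  rw [← I.φ_tgt_symm g]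
  exact I.φ.injective.eq_iff

theorem isBundleIso_trans :
    IsBundleIso R.μ₁ (R.transMoment I) S₁.E S₂.E (R.transFibreEquivs I) := by
  refine ⟨I.smooth_Ψ.comp R.isBundleIso.1, ?_⟩
  refine R.isBundleIso.2.comp (contMDiff_pullback (μ := R.μ₂) (F := G.E)
    (f := fun z : TotalSpace S₂.E.Model ((R.transMoment I : R.P → X₂) *ᵖ S₂.E.Fib) =>
      (⟨z.1, (I.Ψ rfl).symm z.2⟩ : TotalSpace G.E.Model ((R.μ₂ : R.P → X) *ᵖ G.E.Fib)))
    (contMDiff_proj _) ?_)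
  refine (I.smooth_Ψ_symm.comp (contMDiff_pullback_lift (R.transMoment I) S₂.E)).congr fun z => ?_
  exact (I.mk_Ψ_symm rfl _).symm

theorem ker_D_transMoment (p : R.P) : (D (R.transMoment I) p).ker = (D R.μ₂ p).ker := by
  have h : D (R.transMoment I) p = (D I.φ (R.μ₂ p)).comp (D R.μ₂ p) :=
    mfderiv_comp p (I.φ.contMDiff.mdifferentiable (by simp) _)
      (R.μ₂.contMDiff.mdifferentiable (by simp) _)
  have hinj : Function.Injective (D I.φ (R.μ₂ p)) :=
    (I.φ.mfderivToContinuousLinearEquiv (by simp) (R.μ₂ p)).injective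
  ext v
  rw [h, LinearMap.mem_ker, LinearMap.mem_ker]
  exact map_eq_zero_iff _ hinj

/-- Only the projection changes, by a diffeomorphism of the base, which preserves its fibres and the
kernel of its differential. -/
theorem isLeftPfaffian_trans : IsLeftPfaffian S₁ R.μ₁ (R.transMoment I) R.act₁ R.θ where
  principal :=
    { R.left.principal with
      submersion_proj := R.left.principal.submersion_proj.diffeo_comp I.φ
      proj_act := fun g p e => congrArg I.φ (R.left.principal.proj_act g p e)
      transitive := fun p p' e => R.left.principal.transitive p p' (I.φ.injective e)
      t2_base := S₂.t2_base
      secondCountable_base := S₂.secondCountable_base }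
  smooth_θ := R.left.smooth_θ
  multiplicative := R.left.multiplicative
  ker_eq p := by
    rw [R.ker_D_transMoment I]
    exact R.left.ker_eq p

theorem isRightPrincipal_trans : IsRightPrincipal S₂.toLieGroupoid (R.transMoment I) R.μ₁
    (fun p g => R.act₂ p (I.Φ.symm g)) := by
  have hR := R.right.principal
  have hiff : ∀ {p g}, R.transMoment I p = S₂.tgt g ↔ R.μ₂ p = G.tgt (I.Φ.symm g) :=
    R.transMoment_eq_iff I
  refine
    { smooth_act := ?_
      μ_act := fun p g e => ?_
      act_mul := fun p g k e e' => ?_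
      act_unit := fun p => ?_
      submersion_μ := hR.submersion_μ.diffeo_comp I.φ
      submersion_proj := hR.submersion_proj
      proj_act := fun p g e => hR.proj_act _ _ (hiff.1 e)
      transitive := fun p p' e => ?_
      free := fun p g e e' => ?_
      proper := ?_
      t2_base := S₁.t2_base
      secondCountable_base := S₁.secondCountable_base }
  · refine ContMDiffOn.comp (t := {z : R.P × G.Arr | R.μ₂ z.1 = G.tgt z.2})
      (f := fun z : R.P × S₂.Arr => (z.1, I.Φ.symm z.2)) hR.smooth_act ?_ fun z hz => hiff.1 hz
    exact (contMDiff_fst.prodMk (I.Φ.symm.contMDiff.comp contMDiff_snd)).contMDiffOn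
  · change I.φ (R.μ₂ _) = _
    rw [hR.μ_act _ _ (hiff.1 e), I.φ_src_symm]
  · rw [I.Φ_symm_mul e', hR.act_mul _ _ _ (hiff.1 e)]
    apply I.φ.injective
    change I.φ _ = I.φ _
    rw [I.φ_src_symm, I.φ_tgt_symm, e']
  · change R.act₂ p (I.Φ.symm (S₂.unit (I.φ (R.μ₂ p)))) = p
    rw [I.Φ_symm_unit, hR.act_unit]
  · obtain ⟨g, h1, h2⟩ := hR.transitive p p' e
    refine ⟨I.Φ g, ?_, by rw [I.Φ.symm_apply_apply, h2]⟩
    rw [hiff, I.Φ.symm_apply_apply, h1]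
  · have h1 := hR.free p _ (hiff.1 e) e'
    rw [← I.Φ.apply_symm_apply g, h1, I.Φ_unit]
    rfl
  · let k : {z : R.P × S₂.Arr // R.transMoment I z.1 = S₂.tgt z.2} ≃ₜ
        {z : R.P × G.Arr // R.μ₂ z.1 = G.tgt z.2} :=
      { toFun := fun z => ⟨(z.1.1, I.Φ.symm z.1.2), hiff.1 z.2⟩
        invFun := fun z => ⟨(z.1.1, I.Φ z.1.2), by
          rw [hiff, I.Φ.symm_apply_apply]
          exact z.2⟩
        left_inv := fun z => Subtype.ext (Prod.ext rfl (I.Φ.apply_symm_apply _))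
        right_inv := fun z => Subtype.ext (Prod.ext rfl (I.Φ.symm_apply_apply _))
        continuous_toFun := by
          refine Continuous.subtype_mk ((continuous_fst.comp continuous_subtype_val).prodMk ?_) _
          exact I.Φ.symm.continuous.comp (continuous_snd.comp continuous_subtype_val)
        continuous_invFun := by
          refine Continuous.subtype_mk ((continuous_fst.comp continuous_subtype_val).prodMk ?_) _
          exact I.Φ.continuous.comp (continuous_snd.comp continuous_subtype_val) }
    exact hR.proper.comp k.isProperMap

theorem isRightPfaffian_trans : IsRightPfaffian S₂ (R.transMoment I) R.μ₁
    (fun p g => R.act₂ p (I.Φ.symm g))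
    (fun p _ hy => (R.transFibreEquivs I p rfl hy).toLinearMap ∘ₗ R.θ p rfl) where
  principal := R.isRightPrincipal_trans I
  smooth_θ := R.left.smooth_θ.comp (R.isBundleIso_trans I).1
  multiplicative p g e v w hvw := by
    have hR := R.right.principal
    have hT := R.isRightPrincipal_trans I
    have e' := (R.transMoment_eq_iff I).1 e
    obtain ⟨γ, β, hγ, hβ, hs⟩ := hT.submersion_μ.exists_hasVelocity S₂.tgt.contMDiff e hvw
    have h1 := hβ.comp (f := I.Φ.symm) I.Φ.symm.contMDiff.contMDiffAt
    have h2 : ∀ᶠ t in 𝓝 0, R.μ₂ (γ t) = G.tgt (I.Φ.symm (β t)) :=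
      hs.mono fun t ht => (R.transMoment_eq_iff I).1 ht
    have h3 := (hγ.comp (f := R.μ₂) R.μ₂.contMDiff.contMDiffAt).of_eq e'
    have h4 := (h1.comp (f := G.tgt) G.tgt.contMDiff.contMDiffAt).congr h2
    have h5 := hR.smooth_act.hasVelocity (p := p) (q := I.Φ.symm g) e' hγ h1 h2
    have h6 := hT.smooth_act.hasVelocity (p := p) (q := g) e hγ hβ hs
    -- Both differentials are velocities of the same curve `γ · Φ⁻¹ β`: the new action
    -- differentiates to the old one applied to the image of `w` under the differential of `Φ⁻¹`.
    have h7 := h6.unique h5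
    have h8 := ((h1.comp (f := I.Φ) I.Φ.contMDiff.contMDiffAt).of_eq
      (I.Φ.apply_symm_apply g)).unique (hβ.congr (Eventually.of_forall fun t =>
        I.Φ.apply_symm_apply (β t)))
    have h9 := R.right.multiplicative p (I.Φ.symm g) e' v _ (h3.unique h4)
    have h10 : I.Φ (G.inv (I.Φ.symm g)) = S₂.inv g := by rw [I.Φ_inv, I.Φ.apply_symm_apply]
    -- Applying `Ψ` to the old multiplicativity turns representation and form of `G` into those of
    -- `S₂`.
    have h11 := congrArg (I.Ψ (I.φ_src_symm g)) h9
    rw [map_add, I.Ψ_rep' h10 _ _ (S₂.src_inv g) (S₂.tgt_inv g) (I.φ_tgt_symm g),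
      I.Ψ_rep' h10 _ _ (S₂.src_inv g) (S₂.tgt_inv g) (I.φ_tgt_symm g),
      ← I.pullback_form' (I.Φ.apply_symm_apply g) rfl rfl _ h8] at h11
    refine Eq.trans ?_ (h11.trans ?_)
    · refine (R.transFibreEquivs_apply I rfl (hR.μ_act p _ e') (I.φ_src_symm g) _ _).trans ?_
      exact congrArg (fun u => I.Ψ (I.φ_src_symm g)
        (R.Φ _ rfl (hR.μ_act p _ e') (R.θ _ rfl u))) h7
    · congr 2
      exact (R.transFibreEquivs_apply I rfl e' (I.φ_tgt_symm g) e _).symm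
  ker_eq p := by
    have h1 : LinearMap.ker ((R.transFibreEquivs I p rfl rfl).toLinearMap ∘ₗ R.θ p rfl) =
        LinearMap.ker (R.θ p rfl) := LinearEquiv.ker_comp _ _
    rw [h1, R.ker_D_transMoment I]
    exact (R.left.ker_eq p).symm

/-- Transport of a bibundle along an isomorphism of the groupoid acting on the right. -/
noncomputable def trans : PrincipalPfaffianBibundle S₁ S₂ where
  P := R.P
  μ₁ := R.μ₁
  μ₂ := R.transMoment I
  act₁ := R.act₁
  act₂ := fun p g => R.act₂ p (I.Φ.symm g)
  θ := R.θ
  Φ := R.transFibreEquivs I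
  isBundleIso := R.isBundleIso_trans I
  left := R.isLeftPfaffian_trans I
  right := R.isRightPfaffian_trans I
  commute g p k e e' := R.commute g p _ e ((R.transMoment_eq_iff I).1 e')
  Φ_left g p e α :=
    (R.transFibreEquivs_apply I _ (R.left.principal.proj_act g p e) rfl _ _).trans
      (congrArg (I.Ψ rfl) (R.Φ_left g p e α))
  Φ_right p g e α := by
    have e' := (R.transMoment_eq_iff I).1 e
    have h : I.Φ (G.inv (I.Φ.symm g)) = S₂.inv g := by rw [I.Φ_inv, I.Φ.apply_symm_apply]
    rw [R.transFibreEquivs_apply I _ (R.right.principal.μ_act p _ e') (I.φ_src_symm g),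
      R.transFibreEquivs_apply I rfl e' (I.φ_tgt_symm g) e, R.Φ_right p _ e',
      I.Ψ_rep' h _ _ (S₂.src_inv g) (S₂.tgt_inv g) (I.φ_tgt_symm g)]

end PrincipalPfaffianBibundle

end Pfaffian

theorem mainTheorem1 {X₁ X₂ : Pfaffian.SmoothManifold.{u}}
    (S₁ : Pfaffian.PfaffianGroupoid X₁) (S₂ : Pfaffian.PfaffianGroupoid X₂) :
    Pfaffian.PfaffianMoritaEquivalent S₁ S₂ ↔
      ∃ (M : Pfaffian.SmoothManifold.{u}) (B : Pfaffian.PrincipalPfaffianBundle S₁ M)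
        (G : Pfaffian.PfaffianGroupoid M),
        Nonempty (Pfaffian.PfaffianGauge B G) ∧ Nonempty (Pfaffian.PfaffianIso G S₂) := by
  constructor
  · rintro ⟨R⟩
    -- The gauge conditions fix the groupoid only up to isomorphism, so `S₂` itself serves as the
    -- gauge groupoid, with the identity isomorphism.
    exact ⟨X₂, R.toBundle, S₂, R.nonempty_gauge, ⟨S₂.isoRefl⟩⟩
  · rintro ⟨M, B, G, ⟨h⟩, ⟨I⟩⟩
    exact ⟨h.toBibundle.trans I⟩
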